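/- For a string $s$ of length $n$, the LZD parsing is $s=p_1p_2\cdots p_z$ where $p_i=p_{i_1}p_{i_2}$, $p_{i_1}$ is the longest prefix of the not yet parsed suffix $s[k..n]$ and $p_{i_2}$ the longest prefix of $s[k+|p_{i_1}|..n]$ lying in $\{p_1,\dots,p_{i-1}\}\cup\Sigma$ (with $p_{i_2}$ empty if $p_{i_1}$ reaches the end of $s$); the LZMW parsing is $s=p_1\cdots p_z$ where $p_i$ is the longest prefix of the not yet parsed suffix lying in $\{p_jp_{j+1}:1\le j\le i-2\}\cup\Sigma$. The naïve parsing algorithms maintain a compacted trie, with edge labels stored as pairs of positions of $s$ and with marked nodes, that initially consists of a root only. To find the longest dictionary string at position $j$, the trie is traversed from the root along the longest prefix $s[j..m]$ of $s[j..n]$ that can be found in the trie; if not even $s[j]$ can be matched, a marked child of the root for the letter $s[j]$ is added and $s[j]$ is the result; otherwise the result is the string of the lowest marked node on the traversed path. LZD performs two such searches per phrase (the second one only if the end of $s$ has not been reached), and then inserts the new phrase $p_i$ in the trie; LZMW performs one search per phrase, and then, if $i\ge 2$, inserts $p_{i-1}p_i$. An insertion traverses the trie from the root along the longest prefix present in the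 trie, creates the missing nodes, and marks the node of the inserted string. The running time is the number of elementary steps: one for each selection of an outgoing edge by its first letter, one for each further comparison of a letter of an edge label with a letter of $s$ (running off the end of $s$ counting as a mismatch), one for each creation of a node by an insertion, and one for each marking of the node of an inserted string. **Theorem.** The naïve LZD and LZMW parsing algorithms take $\Omega(n^{5/4})$ time in the worst case. That is, for each of the two algorithms there are a constant $c>0$ and an $N$ such that for every $n\ge N$ there is a string $s$ of length $n$ over the alphabet $\mathbb{N}$, whose last letter does not occur elsewhere in $s$, on which the algorithm takes at least $c\,n^{5/4}$ steps. -/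

import Mathlib

namespace NaiveLZ

/-!  Compacted tries whose edge labels are pairs of positions of the input string, and the naive
trie-based LZD and LZMW parsing algorithms, instrumented with a count of elementary operations.
Positions are numbered from `0`; the pair `(l, r)` denotes the factor `s[l], …, s[r-1]`. -/

/-- The collection of outgoing edges of a node of a compacted trie.  `edge l r marked sub rest`
consists of an edge labelled by the factor `(l, r)` of the input string that leads to a child node
with mark `marked` and outgoing edges `sub`, and of the remaining outgoing edges `rest` of the same
node.  A trie is given by the outgoing edges of its root (the root is never marked); the trie that
has only a root is `leaf`. -/
inductive Trie where
  | leaf : Trie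
  | edge (l r : ℕ) (marked : Bool) (sub rest : Trie) : Trie

/-- Compare `s[i], s[i+1], …` with `s[j], s[j+1], …` letter by letter, for at most `m` letters and
up to the first mismatch (running off the end of `s` at `j` is a mismatch).  Returns the number of
letters that agree and the number of comparisons made. -/
def compareLetters {α : Type*} [DecidableEq α] (s : List α) : ℕ → ℕ → ℕ → ℕ × ℕ
  | _, _, 0 => (0, 0)
  | i, j, m + 1 =>
    if s[i]? = s[j]? then
      let c := compareLetters s (i + 1) (j + 1) m
      (c.1 + 1, c.2 + 1)
    else (0, 1)

/-- Result of a downward traversal: `matched` is the length of the longest prefix found in the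
trie, `lowest` is the string depth of the lowest marked node on the path spelling this prefix
(`0` if there is none), `steps` is the number of elementary operations performed. -/
structure Found where
  matched : ℕ
  lowest : ℕ
  steps : ℕ

/-- Traverse the trie downwards, from a node of string depth `depth`, along the longest prefix of
`s[p], s[p+1], …`; `lowest` is the depth of the lowest marked node met so far.  At each node one
step is charged for selecting the outgoing edge with the right first letter (or finding that there
is none), irrespective of the number of edges; then one step is charged for each further comparison
of a letter of the edge label. -/
def search {α : Type*} [DecidableEq α] (s : List α) : Trie → ℕ → ℕ → ℕ → Found
  | .leaf, _, depth, lowest => ⟨depth, lowest, 1⟩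
  | .edge l r marked sub rest, p, depth, lowest =>
    if s[l]? = s[p]? then
      let c := compareLetters s (l + 1) (p + 1) (r - l - 1)
      if c.1 = r - l - 1 then
        let depth' := depth + (r - l)
        let f := search s sub (p + (r - l)) depth' (if marked then depth' else lowest)
        ⟨f.matched, f.lowest, 1 + c.2 + f.steps⟩
      else ⟨depth + 1 + c.1, lowest, 1 + c.2⟩
    else search s rest p depth lowest

/-- Insert the nonempty factor `(p, e)` of `s` below a node: traverse the trie along the longest
prefix of this factor that is present, create the missing nodes (none, one or two), and mark the
node representing the factor.  Returns the new trie and the number of steps: edge selections and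
letter comparisons of the traversal, charged as in `search`, plus one per created node, plus one for
the marking. -/
def insert {α : Type*} [DecidableEq α] (s : List α) : Trie → ℕ → ℕ → Trie × ℕ
  | .leaf, p, e => (.edge p e true .leaf .leaf, 1 + 1 + 1)
  | .edge l r marked sub rest, p, e =>
    if s[l]? = s[p]? then
      let c := compareLetters s (l + 1) (p + 1) (min (r - l) (e - p) - 1)
      let d := c.1 + 1
      if d = e - p then
        if d = r - l then
          (.edge l r true sub rest, 1 + c.2 + 1)
        else
          (.edge l (l + d) true (.edge (l + d) r marked sub .leaf) rest, 1 + c.2 + 1 + 1)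
      else if d = r - l then
        let q := insert s sub (p + d) e
        (.edge l r marked q.1 rest, 1 + c.2 + q.2)
      else
        (.edge l (l + d) false
          (.edge (l + d) r marked sub (.edge (p + d) e true .leaf .leaf)) rest, 1 + c.2 + 2 + 1)
    else
      let q := insert s rest p e
      (.edge l r marked sub q.1, q.2)

/-- Find the longest marked string of the trie that is a prefix of `s[p], s[p+1], …`; if not even
`s[p]` can be matched, this is the leftmost occurrence of a letter, which is then inserted in the
trie as a marked child of the root, and is returned.  The result is the length of the string, the
resulting trie and the number of steps. -/
def findFactor {α : Type*} [DecidableEq α] (s : List α) (T : Trie) (p : ℕ) : ℕ × Trie × ℕ :=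
  let f := search s T p 0 0
  if f.matched = 0 then
    let q := insert s T p (p + 1)
    (1, q.1, f.steps + q.2)
  else (f.lowest, T, f.steps)

/-- The outcome of a parsing algorithm: the lengths of the phrases in order, and the number of
elementary steps performed. -/
structure Run where
  phrases : List ℕ
  steps : ℕ

/-- Main loop of the naive LZD algorithm, with trie `T`, when `s[0], …, s[p-1]` have been parsed
already.  The next phrase consists of two consecutively found factors (just one if the first
reaches the end of `s`) and is inserted in the trie.  The first argument bounds the number of
iterations; every phrase is nonempty, so `s.length` iterations are enough. -/
def lzdLoop {α : Type*} [DecidableEq α] (s : List α) : ℕ → Trie → ℕ → Run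
  | 0, _, _ => ⟨[], 0⟩
  | fuel + 1, T, p =>
    if p < s.length then
      let a := findFactor s T p
      let b := if p + a.1 < s.length then findFactor s a.2.1 (p + a.1) else (0, a.2.1, 0)
      let e := p + a.1 + b.1
      let q := insert s b.2.1 p e
      let R := lzdLoop s fuel q.1 e
      ⟨(e - p) :: R.phrases, a.2.2 + b.2.2 + q.2 + R.steps⟩
    else ⟨[], 0⟩

/-- The naive LZD parsing algorithm. -/
def lzd {α : Type*} [DecidableEq α] (s : List α) : Run :=
  lzdLoop s s.length .leaf 0

/-- Main loop of the naive LZMW algorithm, with trie `T`, when `s[0], …, s[p-1]` have been parsed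
already and the last phrase found has length `prev` (`0` if there is none yet).  After the next
phrase has been found, the concatenation of the last two phrases is inserted in the trie. -/
def lzmwLoop {α : Type*} [DecidableEq α] (s : List α) : ℕ → Trie → ℕ → ℕ → Run
  | 0, _, _, _ => ⟨[], 0⟩
  | fuel + 1, T, prev, p =>
    if p < s.length then
      let a := findFactor s T p
      let q := if prev = 0 then (a.2.1, 0) else insert s a.2.1 (p - prev) (p + a.1)
      let R := lzmwLoop s fuel q.1 a.1 (p + a.1)
      ⟨a.1 :: R.phrases, a.2.2 + q.2 + R.steps⟩
    else ⟨[], 0⟩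

/-- The naive LZMW parsing algorithm. -/
def lzmw {α : Type*} [DecidableEq α] (s : List α) : Run :=
  lzmwLoop s s.length .leaf 0 0

/-- The last letter of `s` is a delimiter that does not occur elsewhere in `s`. -/
def EndsWithDelimiter {α : Type*} (s : List α) : Prop :=
  ∃ (t : List α) (d : α), s = t ++ [d] ∧ d ∉ t

end NaiveLZ

/-!
A single string serves both algorithms, and it even costs them `Ω(n ^ (4 / 3))` steps.

A search may match a long string of the trie although it returns only a short one. The string
below provokes this over and over. Take a word of distinct letters, divided into `k` blocks of
about `3 k` letters. First the suffixes of the word that start at the blocks are put into the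
dictionary, which costs a text of length `O(k ^ 3)`, together with prefixes of the blocks of
length `2`. Then the word, without its very last letter, is read `k` times. In phase `i`, the
longest dictionary string at the beginning of a block is a prefix of the block of length `3 i +
2`, because the suffix of the word does not match to its very end; but the search runs to the end
of the word, and hence costs `Ω(k ^ 2)` for half of the blocks. The rest of the block is cut into
only three more factors: two letters, and a suffix of the block that has been put into the
dictionary before. So a text of length `O(k ^ 3)` is parsed in `Ω(k * k * k ^ 2)` steps. Between
two phases, the prefixes of the blocks are extended explicitly. The starting points of the cuts
within the block move by three letters in each phase, so that none of the concatenations that LZD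
or LZMW inserts during a phase can disturb a later one.

All parts of the text are separated by letters that are used only once, so the dictionaries
consist of intervals of the word, apart from single letters and strings that will never occur
again. LZD inserts the concatenations of every other pair of consecutive factors, LZMW those of
all pairs. Accordingly, a lower bound for the dictionaries (the relations `Lo` below) and an upper
bound (`Up`) are maintained; a factor is found by both algorithms if it is a letter or listed in
`Lo`, and no longer string in `Up` matches the text.

`search_spec` and `insert_spec` describe the tries by the strings they represent. Based on them,
`lzd_pairRule` and `lzmw_pairRule` establish what the two algorithms have in common, from which
`Path.bound` derives that both parse a text as planned whenever the numerical conditions of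
`ChunkOK` hold. `reachable_hard` constructs the text and verifies these conditions.
-/

namespace NaiveLZ

/-! ### Tries and the strings they represent -/

section Trie

variable {α : Type*}

/-- The factor `s[l], …, s[r-1]`. -/
def factor (s : List α) (l r : ℕ) : List α := (s.drop l).take (r - l)

/-- `T.Marked s w`: the string `w` is represented by a marked node of `T`. -/
def Trie.Marked (s : List α) : Trie → List α → Prop
  | .leaf, _ => False
  | .edge l r m sub rest, w =>
    (m = true ∧ w = factor s l r) ∨ (∃ v, w = factor s l r ++ v ∧ sub.Marked s v) ∨ rest.Marked s w

/-- `T.HasHead s c`: some edge leaving the root of `T` starts with the letter `c`. -/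
def Trie.HasHead (s : List α) : Trie → α → Prop
  | .leaf, _ => False
  | .edge l _ _ _ rest, c => s[l]? = some c ∨ rest.HasHead s c

/-- All edge labels are nonempty factors of `s`, and edges leaving the same node start with
different letters. -/
def Trie.WF (s : List α) : Trie → Prop
  | .leaf => True
  | .edge l r _ sub rest =>
    l < r ∧ r ≤ s.length ∧ sub.WF s ∧ rest.WF s ∧ ∀ c, s[l]? = some c → ¬ rest.HasHead s c

theorem length_factor {s : List α} {l r : ℕ} (h : r ≤ s.length) : (factor s l r).length = r - l := by
  simp only [factor, List.length_take, List.length_drop]; omega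

theorem getElem?_factor (s : List α) (l r k : ℕ) :
    (factor s l r)[k]? = if k < r - l then s[l + k]? else none := by
  simp [factor, List.getElem?_take, List.getElem?_drop]

theorem factor_append (s : List α) {l m r : ℕ} (h₁ : l ≤ m) (h₂ : m ≤ r) :
    factor s l m ++ factor s m r = factor s l r := by
  have h : s.drop m = (s.drop l).drop (m - l) := by
    rw [List.drop_drop]; congr 1; omega
  unfold factor
  rw [h, show r - l = (m - l) + (r - m) by omega, List.take_add]

theorem factor_append_drop (s : List α) {p q : ℕ} (h : p ≤ q) :
    factor s p q ++ s.drop q = s.drop p := by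
  have h' : s.drop q = (s.drop p).drop (q - p) := by
    rw [List.drop_drop]; congr 1; omega
  rw [h', factor, List.take_append_drop]

theorem factor_congr {s : List α} {l p d : ℕ} (h : ∀ k < d, s[l + k]? = s[p + k]?) :
    factor s l (l + d) = factor s p (p + d) := by
  apply List.ext_getElem?
  intro k
  simp only [getElem?_factor, Nat.add_sub_cancel_left]
  split_ifs with hk
  · exact h k hk
  · rfl

/-- If `v` is a prefix of a suffix of `s` and of a string that disagrees with it after `d` letters,
then `v` has at most `d` letters. -/
theorem length_le_of_mismatch {s u v : List α} {p d : ℕ} (hu : u[d]? ≠ s[p + d]?) (h₁ : v <+: u)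
    (h₂ : v <+: s.drop p) : v.length ≤ d := by
  by_contra! h
  rw [List.prefix_iff_getElem?] at h₁ h₂
  have h₃ := h₂ d h
  rw [List.getElem?_drop] at h₃
  exact hu (by rw [h₁ d h, h₃])

theorem Trie.Marked.exists_head {s : List α} {T : Trie} {w : List α} (hT : T.WF s)
    (h : T.Marked s w) : ∃ c v, w = c :: v ∧ T.HasHead s c := by
  induction T with
  | leaf => exact h.elim
  | edge l r m sub rest _ ih =>
    obtain ⟨hlr, hr, -, hrest, -⟩ := hT
    have hf : factor s l r = s[l] :: factor s (l + 1) r := by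
      rw [← factor_append s (m := l + 1) (by omega) (by omega)]
      have hl : l < s.length := by omega
      simp [factor, List.take_one, List.head?_drop, hl]
    rcases h with ⟨-, rfl⟩ | ⟨v, rfl, -⟩ | h
    · exact ⟨_, _, hf, Or.inl (by simp)⟩
    · exact ⟨_, _, by rw [hf]; rfl, Or.inl (by simp)⟩
    · obtain ⟨c, v, rfl, hc⟩ := ih hrest h
      exact ⟨c, v, rfl, Or.inr hc⟩

/-- A string starting with a letter that begins no edge at the root has no nonempty prefix in common
with a marked string. -/
theorem Trie.Marked.eq_nil_of_not_hasHead {s : List α} {T : Trie} {w v u : List α} {c : α}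
    (hT : T.WF s) (h : T.Marked s w) (hc : ¬ T.HasHead s c) (hv : v <+: w) (hu : v <+: u)
    (hu' : u[0]? = some c) : v = [] := by
  obtain ⟨d, w, rfl, hd⟩ := h.exists_head hT
  cases v with
  | nil => rfl
  | cons a v =>
    obtain ⟨t, ht⟩ := hv
    obtain ⟨t', rfl⟩ := hu
    simp at ht hu'
    exact absurd (by rwa [← hu', ht.1]) hc

/-- The invariant of the tries built by the parsing algorithms: whenever a letter begins an edge at
the root, the letter itself is marked. -/
def Trie.Good (s : List α) (T : Trie) : Prop :=
  T.WF s ∧ ∀ c, T.HasHead s c → T.Marked s [c]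

theorem Trie.good_leaf (s : List α) : Trie.leaf.Good s := ⟨trivial, fun _ h => h.elim⟩

variable [DecidableEq α]

theorem compareLetters_spec (s : List α) (i j m : ℕ) :
    (compareLetters s i j m).1 ≤ m ∧ (compareLetters s i j m).1 ≤ (compareLetters s i j m).2 ∧
    (∀ k < (compareLetters s i j m).1, s[i + k]? = s[j + k]?) ∧
    ((compareLetters s i j m).1 < m →
      s[i + (compareLetters s i j m).1]? ≠ s[j + (compareLetters s i j m).1]?) := by
  induction m generalizing i j with
  | zero => simp [compareLetters]
  | succ m ih =>
    obtain ⟨h₁, h₂, h₃, h₄⟩ := ih (i + 1) (j + 1)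
    rw [compareLetters]
    split_ifs with h
    · refine ⟨by simpa using h₁, by simpa using h₂, fun k hk => ?_, fun hk => ?_⟩
      · cases k with
        | zero => simpa using h
        | succ k => have := h₃ k (by simpa using hk); rwa [add_right_comm, add_right_comm j] at this
      · have := h₄ (by simpa using hk)
        rwa [add_right_comm, add_right_comm j] at this
    · simp [h]

/-- The comparison of an edge label with a factor, once their first letters have been found to
agree, in terms of the length `d` of the common prefix within the first `m` letters. -/
theorem compareLetters_edge {s : List α} {l p m : ℕ} (h : s[l]? = s[p]?) (hm : 0 < m) :
    let c := compareLetters s (l + 1) (p + 1) (m - 1)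
    c.1 + 1 ≤ m ∧ c.1 ≤ c.2 ∧ (∀ k < c.1 + 1, s[l + k]? = s[p + k]?) ∧
    (c.1 + 1 < m → s[l + (c.1 + 1)]? ≠ s[p + (c.1 + 1)]?) := by
  obtain ⟨h₁, h₂, h₃, h₄⟩ := compareLetters_spec s (l + 1) (p + 1) (m - 1)
  dsimp only
  refine ⟨by omega, h₂, fun k hk => ?_, fun hk => ?_⟩
  · cases k with
    | zero => simpa using h
    | succ k =>
      have := h₃ k (by omega)
      rwa [show l + 1 + k = l + (k + 1) by omega, show p + 1 + k = p + (k + 1) by omega] at this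
  · have := h₄ (by omega)
    rwa [add_assoc, add_assoc, add_comm 1] at this

theorem le_matched_search (s : List α) (T : Trie) (p depth low : ℕ) :
    depth ≤ (search s T p depth low).matched := by
  induction T generalizing p depth low with
  | leaf => simp [search]
  | edge l r m sub rest ih₁ ih₂ =>
    unfold search
    by_cases h : s[l]? = s[p]?
    · rw [if_pos h]
      dsimp only
      split_ifs <;> dsimp only
      · exact le_trans (by omega) (ih₁ _ (depth + (r - l)) _)
      · exact le_trans (by omega) (ih₁ _ (depth + (r - l)) _)
      · omega
    · rw [if_neg h]
      exact ih₂ _ _ _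

/-- A search finds the longest marked prefix of the suffix of `s` at `p`; it matches, and pays for,
at least the longest common prefix of this suffix with any marked string. -/
theorem search_spec {s : List α} {T : Trie} (hT : T.WF s) (p depth low : ℕ) :
    (search s T p depth low).matched ≤ depth + (search s T p depth low).steps ∧
    (∀ w v, T.Marked s w → v <+: w → v <+: s.drop p →
      depth + v.length ≤ (search s T p depth low).matched) ∧
    (depth < (search s T p depth low).matched → ∃ c, s[p]? = some c ∧ T.HasHead s c) ∧
    (((search s T p depth low).lowest = low ∧ ∀ w, T.Marked s w → ¬ w <+: s.drop p) ∨
      ∃ w, T.Marked s w ∧ w <+: s.drop p ∧ (search s T p depth low).lowest = depth + w.length ∧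
        ∀ w', T.Marked s w' → w' <+: s.drop p → w'.length ≤ w.length) := by
  induction T generalizing p depth low with
  | leaf => simp [search, Trie.Marked]
  | edge l r m sub rest ih₁ ih₂ =>
    obtain ⟨hlr, hr, hsub, hrest, hne⟩ := hT
    have hl : s[l]? = some s[l] := by simp
    have hlen := length_factor (s := s) (l := l) hr
    unfold search
    by_cases hlp : s[l]? = s[p]?
    · have hrest' : ∀ w v, rest.Marked s w → v <+: w → v <+: s.drop p → v = [] := fun w v h h₁ h₂ =>
        h.eq_nil_of_not_hasHead hrest (hne _ hl) h₁ h₂ (by simp [← hlp])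
      have hrest'' : ∀ w, rest.Marked s w → ¬ w <+: s.drop p := fun w h h₁ => by
        obtain ⟨c, v, rfl, -⟩ := h.exists_head hrest
        simpa using hrest' _ _ h List.prefix_rfl h₁
      obtain ⟨hc₁, hc₂, hc₃, hc₄⟩ := compareLetters_edge (m := r - l) hlp (by omega)
      rw [if_pos hlp]
      dsimp only
      generalize compareLetters s (l + 1) (p + 1) (r - l - 1) = c at *
      by_cases hfull : c.1 = r - l - 1
      · rw [if_pos hfull]
        have hlab : factor s l r = factor s p (p + (r - l)) := by
          have := factor_congr (d := r - l) (fun k hk => hc₃ k (by omega))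
          rwa [show l + (r - l) = r by omega] at this
        have hdrop : s.drop p = factor s l r ++ s.drop (p + (r - l)) := by
          rw [hlab, factor_append_drop _ (by omega)]
        obtain ⟨i₁, i₂, i₃, i₄⟩ := ih₁ hsub (p + (r - l)) (depth + (r - l))
          (if m = true then depth + (r - l) else low)
        have i₅ : depth + (r - l) ≤ (search s sub (p + (r - l)) (depth + (r - l))
            (if m = true then depth + (r - l) else low)).matched := le_matched_search ..
        generalize search s sub (p + (r - l)) (depth + (r - l))
            (if m = true then depth + (r - l) else low) = f at *
        refine ⟨by dsimp only; omega, fun w v hw hv hv' => ?_, fun _ => ⟨s[l], by rw [← hlp, hl],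
          Or.inl hl⟩, ?_⟩
        · rcases hw with ⟨-, rfl⟩ | ⟨w, rfl, hw⟩ | hw
          · have := hv.length_le
            dsimp only; omega
          · rw [hdrop] at hv'
            by_cases hvl : v.length ≤ r - l
            · dsimp only; omega
            · obtain ⟨t, rfl⟩ := List.prefix_of_prefix_length_le (List.prefix_append (factor s l r) w)
                hv (by omega)
              rw [List.prefix_append_right_inj] at hv hv'
              have := i₂ w t hw hv hv'
              rw [List.length_append, hlen]
              dsimp only; omega
          · rw [hrest' w v hw hv hv']
            dsimp only [List.length_nil]; omega
        · dsimp only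
          rcases i₄ with ⟨hf, hno⟩ | ⟨w, hw, hwp, hf, hmax⟩
          · cases m with
            | true =>
              refine Or.inr ⟨_, Or.inl ⟨rfl, rfl⟩, ?_, by rw [hlen, hf]; rfl, ?_⟩
              · rw [hdrop]; exact List.prefix_append _ _
              · rintro w' (⟨-, rfl⟩ | ⟨w', rfl, hw'⟩ | hw') hp
                · rfl
                · rw [hdrop, List.prefix_append_right_inj] at hp
                  exact absurd hp (hno _ hw')
                · exact absurd hp (hrest'' _ hw')
            | false =>
              refine Or.inl ⟨hf, ?_⟩
              rintro w' (⟨h, -⟩ | ⟨w', rfl, hw'⟩ | hw') hp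
              · exact absurd h (by simp)
              · rw [hdrop, List.prefix_append_right_inj] at hp
                exact absurd hp (hno _ hw')
              · exact absurd hp (hrest'' _ hw')
          · refine Or.inr ⟨factor s l r ++ w, Or.inr (Or.inl ⟨w, rfl, hw⟩), ?_, ?_, ?_⟩
            · rwa [hdrop, List.prefix_append_right_inj]
            · rw [hf, List.length_append, hlen]; omega
            · rintro w' (⟨-, rfl⟩ | ⟨w', rfl, hw'⟩ | hw') hp
              · simp
              · rw [hdrop, List.prefix_append_right_inj] at hp
                simpa using hmax _ hw' hp
              · exact absurd hp (hrest'' _ hw')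
      · rw [if_neg hfull]
        have hmis : ∀ u, (factor s l r ++ u)[c.1 + 1]? ≠ s[p + (c.1 + 1)]? := fun u => by
          rw [List.getElem?_append_left (by omega), getElem?_factor, if_pos (by omega)]
          exact hc₄ (by omega)
        refine ⟨by dsimp only; omega, fun w v hw hv hv' => ?_, fun _ => ⟨s[l], by rw [← hlp, hl],
          Or.inl hl⟩, Or.inl ⟨rfl, ?_⟩⟩
        · dsimp only
          rcases hw with ⟨-, rfl⟩ | ⟨w, rfl, hw⟩ | hw
          · have := length_le_of_mismatch (hmis []) (by simpa using hv) hv'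
            omega
          · have := length_le_of_mismatch (hmis w) hv hv'
            omega
          · rw [hrest' w v hw hv hv', List.length_nil]
            omega
        · rintro w (⟨-, rfl⟩ | ⟨w, rfl, hw⟩ | hw) hp
          · have := length_le_of_mismatch (hmis []) (by simp) hp
            omega
          · have := length_le_of_mismatch (hmis w) List.prefix_rfl hp
            rw [List.length_append] at this
            omega
          · exact hrest'' _ hw hp
    · rw [if_neg hlp]
      obtain ⟨i₁, i₂, i₃, i₄⟩ := ih₂ hrest p depth low
      have hno : ∀ u v, v <+: factor s l r ++ u → v <+: s.drop p → v.length = 0 := fun u v h₁ h₂ => by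
        have := length_le_of_mismatch (d := 0) (u := factor s l r ++ u) ?_ h₁ h₂
        · omega
        · rw [List.getElem?_append_left (by omega), getElem?_factor, if_pos (by omega)]
          exact hlp
      have hle : depth ≤ (search s rest p depth low).matched := le_matched_search ..
      refine ⟨i₁, fun w v hw hv hv' => ?_, fun h => ?_, ?_⟩
      · rcases hw with ⟨-, rfl⟩ | ⟨w, rfl, hw⟩ | hw
        · rw [hno [] v (by simpa using hv) hv']; exact hle
        · rw [hno w v hv hv']; exact hle
        · exact i₂ w v hw hv hv'
      · obtain ⟨c, hc, hc'⟩ := i₃ h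
        exact ⟨c, hc, Or.inr hc'⟩
      · have hno' : ∀ w, (Trie.edge l r m sub rest).Marked s w → w <+: s.drop p →
            rest.Marked s w := by
          rintro w (⟨-, rfl⟩ | ⟨w, rfl, hw⟩ | hw) hp
          · have := hno [] _ (by simp) hp; omega
          · have := hno w _ List.prefix_rfl hp
            rw [List.length_append] at this; omega
          · exact hw
        rcases i₄ with ⟨hf, h⟩ | ⟨w, hw, hwp, hf, hmax⟩
        · exact Or.inl ⟨hf, fun w hw hp => h w (hno' w hw hp) hp⟩
        · exact Or.inr ⟨w, Or.inr (Or.inr hw), hwp, hf, fun w' h h' => hmax w' (hno' w' h h') h'⟩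

/-- Inserting a factor adds exactly this factor to the marked strings. -/
theorem insert_spec {s : List α} {T : Trie} (hT : T.WF s) {p e : ℕ} (hpe : p < e)
    (he : e ≤ s.length) :
    (insert s T p e).1.WF s ∧
    (∀ c, (insert s T p e).1.HasHead s c ↔ T.HasHead s c ∨ s[p]? = some c) ∧
    (∀ w, (insert s T p e).1.Marked s w ↔ T.Marked s w ∨ w = factor s p e) := by
  induction T generalizing p with
  | leaf => simp [insert, Trie.WF, Trie.HasHead, Trie.Marked, hpe, he]
  | edge l r m sub rest ih₁ ih₂ =>
    obtain ⟨hlr, hr, hsub, hrest, hne⟩ := hT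
    unfold insert
    by_cases hlp : s[l]? = s[p]?
    · obtain ⟨hc₁, hc₂, hc₃, hc₄⟩ := compareLetters_edge (m := min (r - l) (e - p)) hlp (by omega)
      rw [if_pos hlp]
      dsimp only
      generalize (compareLetters s (l + 1) (p + 1) (min (r - l) (e - p) - 1)).1 = d at *
      generalize hd' : d + 1 = d' at *
      have hlab := factor_congr hc₃
      have hd0 : 0 < d' := by omega
      by_cases h₁ : d' = e - p
      · have hp : p + d' = e := by omega
        rw [hp] at hlab
        rw [if_pos h₁]
        by_cases h₂ : d' = r - l
        · have hl : l + d' = r := by omega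
          rw [hl] at hlab
          rw [if_pos h₂]
          refine ⟨⟨hlr, hr, hsub, hrest, hne⟩, fun c => ?_, fun w => ?_⟩
          · simp only [Trie.HasHead, ← hlp]; tauto
          · simp only [Trie.Marked, ← hlab, true_and]; grind
        · rw [if_neg h₂]
          refine ⟨⟨by omega, by omega, ⟨by omega, hr, hsub, trivial, fun _ _ => id⟩, hrest, hne⟩,
            fun c => ?_, fun w => ?_⟩
          · simp only [Trie.HasHead, ← hlp]; tauto
          · rw [← hlab]
            simp only [Trie.Marked, ← factor_append s (show l ≤ l + d' by omega)
              (show l + d' ≤ r by omega), or_false, List.append_assoc]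
            constructor
            · rintro (⟨-, rfl⟩ | ⟨v, rfl, ⟨hm, rfl⟩ | ⟨v, rfl, hv⟩⟩ | h)
              · exact Or.inr rfl
              · exact Or.inl (Or.inl ⟨hm, rfl⟩)
              · exact Or.inl (Or.inr (Or.inl ⟨v, rfl, hv⟩))
              · exact Or.inl (Or.inr (Or.inr h))
            · rintro ((⟨hm, rfl⟩ | ⟨v, rfl, hv⟩ | h) | rfl)
              · exact Or.inr (Or.inl ⟨_, rfl, Or.inl ⟨hm, rfl⟩⟩)
              · exact Or.inr (Or.inl ⟨_, rfl, Or.inr ⟨v, rfl, hv⟩⟩)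
              · exact Or.inr (Or.inr h)
              · exact Or.inl ⟨trivial, rfl⟩
      · rw [if_neg h₁]
        have hfac := factor_append s (show p ≤ p + d' by omega) (show p + d' ≤ e by omega)
        by_cases h₂ : d' = r - l
        · have hl : l + d' = r := by omega
          rw [hl] at hlab
          rw [if_pos h₂]
          obtain ⟨i₁, i₂, i₃⟩ := ih₁ hsub (p := p + d') (by omega)
          refine ⟨⟨hlr, hr, i₁, hrest, hne⟩, fun c => ?_, fun w => ?_⟩
          · simp only [Trie.HasHead, ← hlp]; tauto
          · simp only [Trie.Marked, i₃]
            rw [← hfac, ← hlab]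
            constructor
            · rintro (h | ⟨v, rfl, hv | rfl⟩ | h)
              · exact Or.inl (Or.inl h)
              · exact Or.inl (Or.inr (Or.inl ⟨v, rfl, hv⟩))
              · exact Or.inr rfl
              · exact Or.inl (Or.inr (Or.inr h))
            · rintro ((h | ⟨v, rfl, hv⟩ | h) | rfl)
              · exact Or.inl h
              · exact Or.inr (Or.inl ⟨v, rfl, Or.inl hv⟩)
              · exact Or.inr (Or.inr h)
              · exact Or.inr (Or.inl ⟨_, rfl, Or.inr rfl⟩)
        · rw [if_neg h₂]
          have hmis := hc₄ (by omega)
          refine ⟨⟨by omega, by omega, ⟨by omega, hr, hsub, ⟨by omega, he, trivial, trivial,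
            fun _ _ => id⟩, fun c hc h => ?_⟩, hrest, hne⟩, fun c => ?_, fun w => ?_⟩
          · simp only [Trie.HasHead, or_false] at h
            exact hmis (by rw [hc, h])
          · simp only [Trie.HasHead, ← hlp]; tauto
          · rw [← hfac, ← hlab]
            simp only [Trie.Marked, ← factor_append s (show l ≤ l + d' by omega)
              (show l + d' ≤ r by omega), or_false, List.append_assoc, Bool.false_eq_true,
              false_and, and_false, exists_false, false_or, true_and]
            constructor
            · rintro (⟨v, rfl, ⟨hm, rfl⟩ | ⟨v, rfl, hv⟩ | rfl⟩ | h)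
              · exact Or.inl (Or.inl ⟨hm, rfl⟩)
              · exact Or.inl (Or.inr (Or.inl ⟨v, rfl, hv⟩))
              · exact Or.inr rfl
              · exact Or.inl (Or.inr (Or.inr h))
            · rintro ((⟨hm, rfl⟩ | ⟨v, rfl, hv⟩ | h) | rfl)
              · exact Or.inl ⟨_, rfl, Or.inl ⟨hm, rfl⟩⟩
              · exact Or.inl ⟨_, rfl, Or.inr (Or.inl ⟨v, rfl, hv⟩)⟩
              · exact Or.inr h
              · exact Or.inl ⟨_, rfl, Or.inr (Or.inr rfl)⟩
    · rw [if_neg hlp]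
      obtain ⟨i₁, i₂, i₃⟩ := ih₂ hrest hpe
      refine ⟨⟨hlr, hr, hsub, i₁, fun c hc h => ?_⟩, fun c => ?_, fun w => ?_⟩
      · rcases (i₂ c).1 h with h | h
        · exact hne c hc h
        · exact hlp (by rw [hc, h])
      · simp only [Trie.HasHead, i₂]; tauto
      · simp only [Trie.Marked, i₃, or_assoc]

theorem Trie.Good.insert {s : List α} {T : Trie} (hT : T.Good s) {p e : ℕ} (hpe : p < e)
    (he : e ≤ s.length) (hp : T.Marked s [s[p]]) : (insert s T p e).1.Good s := by
  obtain ⟨h₁, h₂, h₃⟩ := insert_spec hT.1 hpe he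
  refine ⟨h₁, fun c hc => (h₃ _).2 (Or.inl ?_)⟩
  rcases (h₂ c).1 hc with h | h
  · exact hT.2 c h
  · rw [List.getElem?_eq_getElem (by omega), Option.some_inj] at h
    rwa [← h]

/-- If `x` is a letter or marked, and no longer marked string is a prefix of the remaining text
`x ++ rest`, then `x` is the factor that is found.  The number of steps is at least the length of
any common prefix of the remaining text and a marked string. -/
theorem findFactor_spec {s : List α} {T : Trie} (hT : T.Good s) {p : ℕ} {x rest : List α}
    (hs : s.drop p = x ++ rest) (hx₀ : x ≠ []) (hx : x.length = 1 ∨ T.Marked s x)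
    (hmax : ∀ w, T.Marked s w → w <+: x ++ rest → w.length ≤ x.length) :
    (findFactor s T p).1 = x.length ∧ (findFactor s T p).2.1.Good s ∧
    (∀ w, T.Marked s w → (findFactor s T p).2.1.Marked s w) ∧
    (∀ w, (findFactor s T p).2.1.Marked s w → T.Marked s w ∨ w.length = 1) ∧
    (∀ c, s[p]? = some c → (findFactor s T p).2.1.Marked s [c]) ∧
    (∀ w v, T.Marked s w → v <+: w → v <+: s.drop p → v.length ≤ (findFactor s T p).2.2) := by
  obtain ⟨h₁, h₂, h₃, h₄⟩ := search_spec hT.1 p 0 0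
  have hx₁ : 0 < x.length := List.length_pos_iff.2 hx₀
  have hp : p < s.length := by
    have := congrArg List.length hs
    rw [List.length_drop, List.length_append] at this
    omega
  unfold findFactor
  dsimp only
  by_cases h : (search s T p 0 0).matched = 0
  · rw [if_pos h]
    have hfac : factor s p (p + 1) = [s[p]] := by
      simp [factor, List.take_one, List.head?_drop, hp]
    have hno : ∀ w, T.Marked s w → ¬ w <+: s.drop p := fun w hw hw' => by
      obtain ⟨c, v, rfl, -⟩ := hw.exists_head hT.1
      have := h₂ _ _ hw List.prefix_rfl hw'
      simp [h] at this
    obtain ⟨j₁, j₂, j₃⟩ := insert_spec hT.1 (show p < p + 1 by omega) (show p + 1 ≤ s.length by omega)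
    rw [hfac] at j₃
    refine ⟨?_, ⟨j₁, fun c hc => (j₃ _).2 ?_⟩, fun w hw => (j₃ w).2 (Or.inl hw), fun w hw => ?_,
      fun c hc => (j₃ _).2 ?_, fun w v hw hv hv' => ?_⟩
    · rcases hx with hx | hx
      · exact hx.symm
      · exact absurd ⟨_, hs.symm⟩ (hno x hx)
    · rcases (j₂ c).1 hc with h | h
      · exact Or.inl (hT.2 c h)
      · rw [List.getElem?_eq_getElem hp, Option.some_inj] at h
        rw [h]; exact Or.inr rfl
    · rcases (j₃ w).1 hw with h | h
      · exact Or.inl h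
      · exact Or.inr (by rw [h]; rfl)
    · rw [List.getElem?_eq_getElem hp, Option.some_inj] at hc
      rw [hc]; exact Or.inr rfl
    · have := h₂ w v hw hv hv'
      dsimp only; omega
  · rw [if_neg h]
    obtain ⟨c, hc, hc'⟩ := h₃ (by omega)
    have hm := hT.2 c hc'
    have hc₁ : [c] <+: s.drop p := by
      rw [List.prefix_iff_getElem?]
      intro i hi
      obtain rfl : i = 0 := by simpa using hi
      simpa using hc
    refine ⟨?_, hT, fun _ => id, fun _ => Or.inl, fun c' h' => ?_, fun w v hw hv hv' => ?_⟩
    · rcases h₄ with ⟨-, h₄⟩ | ⟨w, hw, hw', hf, hwm⟩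
      · exact absurd hc₁ (h₄ _ hm)
      · refine le_antisymm ?_ ?_
        · have := hmax w hw (hs ▸ hw')
          dsimp only; omega
        · rcases hx with hx | hx
          · have := hwm _ hm hc₁
            rw [List.length_singleton] at this
            dsimp only; omega
          · have := hwm _ hx ⟨_, hs.symm⟩
            dsimp only; omega
    · rw [hc, Option.some_inj] at h'
      rwa [← h']
    · have := h₂ w v hw hv hv'
      dsimp only; omega

end Trie

/-! ### One round of LZD and LZMW -/

section Rounds

variable {α : Type*}

theorem drop_add_length {s x rest : List α} {p : ℕ} (h : s.drop p = x ++ rest) :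
    s.drop (p + x.length) = rest := by
  rw [← List.drop_drop, h, List.drop_left]

theorem factor_eq_of_drop {s x rest : List α} {p : ℕ} (h : s.drop p = x ++ rest) :
    factor s p (p + x.length) = x := by
  rw [factor, h, Nat.add_sub_cancel_left, List.take_left]

theorem add_length_le_of_drop {s x rest : List α} {p : ℕ} (h : s.drop p = x ++ rest) (hx : x ≠ []) :
    p + x.length + rest.length = s.length := by
  have := congrArg List.length h
  have := List.length_pos_iff.2 hx
  rw [List.length_drop, List.length_append] at *
  omega

/-- The first letter of the last factor before `p`, which has length `prev` (`0` if there is none),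
is marked. -/
def PrevMarked (s : List α) (T : Trie) (prev p : ℕ) : Prop :=
  prev ≤ p ∧ (0 < prev → ∀ c, s[p - prev]? = some c → T.Marked s [c])

/-- The common behaviour of LZD and LZMW on two consecutive factors `x` and `y`.  The predicate
`F T prev p N` stands for: the algorithm takes at least `N` steps from the situation where it has
parsed `s` up to `p`, the last factor found has length `prev`, and the trie is `T`.  LZD inserts
`x ++ y`; LZMW first inserts the concatenation of the previous factor and `x`, too. The hypotheses
suffice for both algorithms to find `x` and `y`, and `K` bounds the cost of finding `x`. -/
def PairRule (s : List α) (F : Trie → ℕ → ℕ → ℕ → Prop) : Prop :=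
  ∀ ⦃T prev p x y rest K N⦄, T.Good s → PrevMarked s T prev p → s.drop p = x ++ (y ++ rest) →
    x ≠ [] → y ≠ [] →
    (x.length = 1 ∨ T.Marked s x) →
    (∀ w, T.Marked s w → w <+: x ++ (y ++ rest) → w.length ≤ x.length) →
    (y.length = 1 ∨ T.Marked s y) →
    (∀ w, T.Marked s w ∨ (0 < prev ∧ w = factor s (p - prev) p ++ x) → w <+: y ++ rest →
      w.length ≤ y.length) →
    (K = 0 ∨ ∃ w v, T.Marked s w ∧ v <+: w ∧ v <+: s.drop p ∧ K ≤ v.length) →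
    (∀ T', T'.Good s → PrevMarked s T' y.length (p + x.length + y.length) →
      (∀ w, T.Marked s w → T'.Marked s w) → T'.Marked s (x ++ y) →
      (∀ w, T'.Marked s w → T.Marked s w ∨ w.length = 1 ∨ w = x ++ y ∨
        (0 < prev ∧ w = factor s (p - prev) p ++ x)) →
      F T' y.length (p + x.length + y.length) N) →
    F T prev p (K + N)

variable [DecidableEq α]

theorem lzd_pairRule (s : List α) : PairRule s fun T _ p N =>
    ∀ fuel, s.length - p ≤ fuel → N ≤ (lzdLoop s fuel T p).steps := by
  intro T prev p x y rest K N hT _ hs hx₀ hy₀ hx hxm hy hym hK hF fuel hfuel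
  have hlen := add_length_le_of_drop hs hx₀
  have hs' := drop_add_length hs
  have hlen' := add_length_le_of_drop hs' hy₀
  have hx₁ := List.length_pos_iff.2 hx₀
  have hy₁ := List.length_pos_iff.2 hy₀
  obtain ⟨fuel, rfl⟩ : ∃ f, fuel = f + 1 := ⟨fuel - 1, by omega⟩
  obtain ⟨a₁, a₂, a₃, a₄, a₅, a₆⟩ := findFactor_spec hT hs hx₀ hx hxm
  unfold lzdLoop
  rw [if_pos (by omega)]
  dsimp only
  generalize findFactor s T p = a at *
  obtain ⟨_, T₁, k₁⟩ := a
  dsimp only at *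
  subst a₁
  rw [if_pos (by omega)]
  obtain ⟨b₁, b₂, b₃, b₄, b₅, -⟩ := findFactor_spec a₂ hs' hy₀ (hy.imp_right (a₃ y)) fun w hw hw' =>
    (a₄ w hw).elim (fun h => hym w (Or.inl h) hw') (fun h => by omega)
  generalize findFactor s T₁ (p + x.length) = b at *
  obtain ⟨_, T₂, k₂⟩ := b
  dsimp only at *
  subst b₁
  have hfac : factor s p (p + x.length + y.length) = x ++ y := by
    have := factor_eq_of_drop (x := x ++ y) (rest := rest) (by rw [hs, List.append_assoc])
    rwa [List.length_append, ← add_assoc] at this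
  obtain ⟨-, -, q₃⟩ := insert_spec b₂.1 (show p < p + x.length + y.length by omega) (by omega)
  have q₁ := b₂.insert (show p < p + x.length + y.length by omega) (by omega)
    (b₃ _ (a₅ _ (List.getElem?_eq_getElem (by omega))))
  rw [hfac] at q₃
  generalize insert s T₂ p (p + x.length + y.length) = q at *
  obtain ⟨T₃, k₃⟩ := q
  dsimp only at *
  have hK' : K ≤ k₁ := by
    rcases hK with rfl | ⟨w, v, hw, hv, hv', hK⟩
    · exact Nat.zero_le _
    · exact hK.trans (a₆ w v hw hv hv')
  have := hF T₃ q₁ ⟨by omega, fun _ c hc => (q₃ _).2 (Or.inl (b₅ c (by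
      rwa [Nat.add_sub_cancel] at hc)))⟩ (fun w hw => (q₃ w).2 (Or.inl (b₃ w (a₃ w hw))))
    ((q₃ _).2 (Or.inr rfl)) (fun w hw => ?_) fuel (by omega)
  · omega
  · rcases (q₃ w).1 hw with h | h
    · rcases b₄ w h with h | h
      · rcases a₄ w h with h | h
        · exact Or.inl h
        · exact Or.inr (Or.inl h)
      · exact Or.inr (Or.inl h)
    · exact Or.inr (Or.inr (Or.inl h))

theorem lzmw_pairRule (s : List α) : PairRule s fun T prev p N =>
    ∀ fuel, s.length - p ≤ fuel → N ≤ (lzmwLoop s fuel T prev p).steps := by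
  intro T prev p x y rest K N hT hprev hs hx₀ hy₀ hx hxm hy hym hK hF fuel hfuel
  have hlen := add_length_le_of_drop hs hx₀
  have hs' := drop_add_length hs
  have hlen' := add_length_le_of_drop hs' hy₀
  have hx₁ := List.length_pos_iff.2 hx₀
  have hy₁ := List.length_pos_iff.2 hy₀
  obtain ⟨fuel, rfl⟩ : ∃ f, fuel = f + 2 := ⟨fuel - 2, by omega⟩
  obtain ⟨a₁, a₂, a₃, a₄, a₅, a₆⟩ := findFactor_spec hT hs hx₀ hx hxm
  unfold lzmwLoop
  rw [if_pos (by omega)]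
  dsimp only
  generalize findFactor s T p = a at *
  obtain ⟨_, T₁, k₁⟩ := a
  dsimp only at *
  subst a₁
  -- the insertion of the concatenation of the previous factor and `x`
  obtain ⟨c₁, c₂⟩ : (if prev = 0 then (T₁, 0) else insert s T₁ (p - prev) (p + x.length)).1.Good s ∧
      ∀ w, (if prev = 0 then (T₁, 0) else insert s T₁ (p - prev) (p + x.length)).1.Marked s w ↔
        T₁.Marked s w ∨ (0 < prev ∧ w = factor s (p - prev) p ++ x) := by
    split_ifs with h
    · exact ⟨a₂, fun w => by simp [h]⟩
    · have hpp := hprev.1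
      obtain ⟨-, -, q₃⟩ := insert_spec a₂.1 (show p - prev < p + x.length by omega) (by omega)
      refine ⟨a₂.insert (by omega) (by omega)
        (a₃ _ (hprev.2 (by omega) _ (List.getElem?_eq_getElem (by omega)))), fun w => ?_⟩
      rw [q₃, ← factor_append s (show p - prev ≤ p by omega) (show p ≤ p + x.length by omega),
        factor_eq_of_drop hs]
      simp [Nat.pos_of_ne_zero h]
  generalize (if prev = 0 then (T₁, 0) else insert s T₁ (p - prev) (p + x.length)) = q at *
  obtain ⟨T₂, k₂⟩ := q
  unfold lzmwLoop
  rw [if_pos (by omega)]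
  dsimp only at *
  rw [if_neg (by omega)]
  obtain ⟨b₁, b₂, b₃, b₄, b₅, -⟩ := findFactor_spec c₁ hs' hy₀
    (hy.imp_right fun h => (c₂ y).2 (Or.inl (a₃ y h))) fun w hw hw' => by
      rcases (c₂ w).1 hw with h | h
      · rcases a₄ w h with h | h
        · exact hym w (Or.inl h) hw'
        · omega
      · exact hym w (Or.inr h) hw'
  generalize findFactor s T₂ (p + x.length) = b at *
  obtain ⟨_, T₃, k₃⟩ := b
  dsimp only at *
  subst b₁
  rw [Nat.add_sub_cancel]
  have hfac : factor s p (p + x.length + y.length) = x ++ y := by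
    have := factor_eq_of_drop (x := x ++ y) (rest := rest) (by rw [hs, List.append_assoc])
    rwa [List.length_append, ← add_assoc] at this
  obtain ⟨-, -, q₃⟩ := insert_spec b₂.1 (show p < p + x.length + y.length by omega) (by omega)
  have q₁ := b₂.insert (show p < p + x.length + y.length by omega) (by omega)
    (b₃ _ ((c₂ _).2 (Or.inl (a₅ _ (List.getElem?_eq_getElem (by omega))))))
  rw [hfac] at q₃
  generalize insert s T₃ p (p + x.length + y.length) = q at *
  obtain ⟨T₄, k₄⟩ := q
  dsimp only at *
  have hK' : K ≤ k₁ := by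
    rcases hK with rfl | ⟨w, v, hw, hv, hv', hK⟩
    · exact Nat.zero_le _
    · exact hK.trans (a₆ w v hw hv hv')
  have := hF T₄ q₁ ⟨by omega, fun _ c hc => (q₃ _).2 (Or.inl (b₅ c (by
      rwa [Nat.add_sub_cancel] at hc)))⟩
    (fun w hw => (q₃ w).2 (Or.inl (b₃ w ((c₂ w).2 (Or.inl (a₃ w hw))))))
    ((q₃ _).2 (Or.inr rfl)) (fun w hw => ?_) fuel (by omega)
  · omega
  · rcases (q₃ w).1 hw with h | h
    · rcases b₄ w h with h | h
      · rcases (c₂ w).1 h with h | h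
        · rcases a₄ w h with h | h
          · exact Or.inl h
          · exact Or.inr (Or.inl h)
        · exact Or.inr (Or.inr (Or.inr h))
      · exact Or.inr (Or.inl h)
    · exact Or.inr (Or.inr (Or.inl h))

end Rounds

/-! ### Texts made of intervals of a word with distinct letters -/

/-- The factor from position `u` up to position `v` (exclusive) of the infinite word
`0, 2, 4, 6, …`, whose letters are distinct. -/
def interval (u v : ℕ) : List ℕ := (List.range' u (v - u)).map (2 * ·)

@[simp]
theorem length_interval (u v : ℕ) : (interval u v).length = v - u := by simp [interval]

theorem interval_append {u m v : ℕ} (h₁ : u ≤ m) (h₂ : m ≤ v) :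
    interval u m ++ interval m v = interval u v := by
  unfold interval
  rw [← List.map_append, show v - u = (m - u) + (v - m) by omega, ← List.range'_append]
  simp [show u + (m - u) = m by omega]

theorem getElem?_interval (u v i : ℕ) :
    (interval u v)[i]? = if i < v - u then some (2 * (u + i)) else none := by
  unfold interval
  split_ifs with h
  · simp [h]
  · simp; omega

/-- A nonempty interval that is a prefix of another one, followed by an odd letter, is an initial
part of the latter. -/
theorem interval_prefix {g e u z j : ℕ} {rest : List ℕ} (hg : interval g e ≠ []) (hu : u < z)
    (h : interval g e <+: interval u z ++ (2 * j + 1) :: rest) : g = u ∧ e ≤ z := by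
  have hlen := List.length_pos_iff.2 hg
  rw [length_interval] at hlen
  rw [List.prefix_iff_getElem?] at h
  have key : ∀ i < e - g, (interval u z ++ (2 * j + 1) :: rest)[i]? = some (2 * (g + i)) := by
    intro i hi
    rw [h i (by simpa using hi), ← List.getElem?_eq_getElem, getElem?_interval, if_pos hi]
  have hgu : g = u := by
    have := key 0 hlen
    rw [List.getElem?_append_left (by simp; omega), getElem?_interval, if_pos (by omega),
      Option.some_inj] at this
    omega
  refine ⟨hgu, ?_⟩
  by_contra! hz
  have := key (z - u) (by omega)
  rw [List.getElem?_append_right (by simp)] at this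
  simp at this
  omega

/-- The relation `R` extended by the pair `(a, b)`. -/
def addPair (R : ℕ → ℕ → Prop) (a b : ℕ) : ℕ → ℕ → Prop := fun g e => R g e ∨ (g = a ∧ e = b)

/-- The strings that LZD inserts while it parses a chunk from `u` on, added to `Lo`.  A chunk is
given by the pairs `(m, v)` of an inner and a right end point of its consecutive pairs of factors,
and a pair `(g, e)` of a relation stands for `interval g e`. -/
def loAfter (Lo : ℕ → ℕ → Prop) : ℕ → List (ℕ × ℕ) → ℕ → ℕ → Prop
  | _, [] => Lo
  | u, (_, v) :: l => loAfter (addPair Lo u v) v l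

/-- The strings that LZMW inserts while it parses a chunk from `u` on, added to `Up`, where the
previous factor starts at `g`.  (At the start of a chunk, the value `g = u` is used, which amounts
to adding the first factor itself; this only weakens the upper bound.) -/
def upAfter (Up : ℕ → ℕ → Prop) : ℕ → ℕ → List (ℕ × ℕ) → ℕ → ℕ → Prop
  | _, _, [] => Up
  | g, u, (m, v) :: l => upAfter (addPair (addPair Up g m) u v) m v l

/-- The algorithms find the factor from `u` to `m` when the text continues up to `z`, if the strings
in `Lo` are in the dictionary and those in `Up` are the only ones that may be. -/
def Greedy (Lo Up : ℕ → ℕ → Prop) (z u m : ℕ) : Prop :=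
  (m = u + 1 ∨ Lo u m) ∧ ∀ e, Up u e → e ≤ z → e ≤ m

/-- All factors of a chunk from `u` to `z` are found by the algorithms, at a cost of at least the
last argument: a search that starts at `u` costs at least `z - u` if the dictionary contains a
string that extends beyond `z`.  Strings inserted while the chunk is parsed need not be considered,
since they start before the current position. -/
inductive ChunkOK (Lo Up : ℕ → ℕ → Prop) (z : ℕ) : ℕ → List (ℕ × ℕ) → ℕ → Prop
  | nil : ChunkOK Lo Up z z [] 0
  | cons {u m v K N : ℕ} {l : List (ℕ × ℕ)} : u < m → m < v → Greedy Lo Up z u m →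
      Greedy Lo Up z m v → (K = 0 ∨ ∃ e, z ≤ e ∧ Lo u e ∧ K ≤ z - u) → ChunkOK Lo Up z v l N →
      ChunkOK Lo Up z u ((m, v) :: l) (K + N)

theorem ChunkOK.le {Lo Up : ℕ → ℕ → Prop} {z u K : ℕ} {l : List (ℕ × ℕ)}
    (h : ChunkOK Lo Up z u l K) : u ≤ z := by
  induction h <;> omega

theorem ChunkOK.mono {Lo Up Lo' Up' : ℕ → ℕ → Prop} {z u K : ℕ} {l : List (ℕ × ℕ)}
    (h : ChunkOK Lo Up z u l K) (hLo : ∀ g e, Lo g e → Lo' g e)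
    (hUp : ∀ g e, u ≤ g → Up' g e → Up g e) : ChunkOK Lo' Up' z u l K := by
  induction h with
  | nil => exact .nil
  | cons h₁ h₂ h₃ h₄ h₅ _ ih =>
    refine .cons h₁ h₂ ⟨h₃.1.imp_right (hLo _ _), fun e he => h₃.2 e (hUp _ _ le_rfl he)⟩
      ⟨h₄.1.imp_right (hLo _ _), fun e he => h₄.2 e (hUp _ _ h₁.le he)⟩ (h₅.imp_right ?_)
      (ih fun g e hg => hUp g e (by omega))
    rintro ⟨e, he, he', hK⟩
    exact ⟨e, he, hLo _ _ he', hK⟩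

/-- At position `p` of `s`, the trie `T` contains the strings in `Lo`, and, apart from single letters
and strings that can no longer occur, only strings in `Up`. -/
structure Dictionary (s : List ℕ) (T : Trie) (p : ℕ) (Lo Up : ℕ → ℕ → Prop) : Prop where
  good : T.Good s
  lo : ∀ g e, Lo g e → T.Marked s (interval g e)
  up : ∀ w, T.Marked s w →
    w.length = 1 ∨ (∃ g e, Up g e ∧ w = interval g e) ∨ ∃ c ∈ w, c ∉ s.drop p

theorem not_mem_drop_of_le {s : List ℕ} {p p' c : ℕ} (h : c ∉ s.drop p) (hp : p ≤ p') :
    c ∉ s.drop p' := fun hc => h <| by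
  obtain ⟨d, rfl⟩ := Nat.exists_eq_add_of_le hp
  rw [← List.drop_drop] at hc
  exact List.mem_of_mem_drop hc

/-- The algorithms find the factors of a chunk. -/
theorem ChunkOK.bound {s : List ℕ} {F : Trie → ℕ → ℕ → ℕ → Prop} (hF : PairRule s F) {z j : ℕ}
    {rest : List ℕ} {l : List (ℕ × ℕ)} {u K g p prev N : ℕ} {Lo Up : ℕ → ℕ → Prop} {T : Trie}
    (h : ChunkOK Lo Up z u l K) (hT : Dictionary s T p Lo Up) (hprev : PrevMarked s T prev p)
    (hs : s.drop p = interval u z ++ (2 * j + 1) :: rest) (hg : g ≤ u)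
    (hprev' : 0 < prev → (g < u ∧ factor s (p - prev) p = interval g u) ∨
      ∃ c ∈ factor s (p - prev) p, c ∉ s.drop p)
    (hN : ∀ T' prev' p', Dictionary s T' p' (loAfter Lo u l) (upAfter Up g u l) →
      PrevMarked s T' prev' p' → s.drop p' = (2 * j + 1) :: rest → F T' prev' p' N) :
    F T prev p (K + N) := by
  induction l generalizing u K g p prev Lo Up T with
  | nil =>
    cases h
    rw [Nat.zero_add]
    exact hN T prev p hT hprev (by simpa [interval] using hs)
  | cons mv l ih =>
    cases h with
    | @cons _ m v K' N' _ h₁ h₂ h₃ h₄ h₅ h₆ =>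
    have hvz := h₆.le
    have hs₁ : s.drop p = interval u m ++ (interval m v ++ (interval v z ++ (2 * j + 1) :: rest)) := by
      rw [hs, ← interval_append (u := u) (m := m) (v := z) (by omega) (by omega),
        ← interval_append (u := m) (m := v) (v := z) (by omega) (by omega)]
      simp only [List.append_assoc]
    have hs₂ : s.drop (p + (m - u)) = interval m z ++ (2 * j + 1) :: rest := by
      have := drop_add_length hs₁
      rw [length_interval] at this
      rw [this, ← interval_append (u := m) (m := v) (v := z) (by omega) (by omega)]
      simp only [List.append_assoc]
    have hs₃ : s.drop (p + (m - u) + (v - m)) = interval v z ++ (2 * j + 1) :: rest := by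
      rw [← interval_append (u := m) (m := v) (v := z) (by omega) (by omega),
        List.append_assoc] at hs₂
      have := drop_add_length hs₂
      rwa [length_interval] at this
    -- a marked string that is a prefix of the remaining text is a letter or listed in `Up`
    have hpre : ∀ w p' u', p ≤ p' → u' < z → s.drop p' = interval u' z ++ (2 * j + 1) :: rest →
        T.Marked s w → w <+: s.drop p' → w.length = 1 ∨ ∃ e, Up u' e ∧ e ≤ z ∧
          w = interval u' e := by
      intro w p' u' hp' hu' hs' hw hw'
      rcases hT.up w hw with h | ⟨a, e, hae, rfl⟩ | ⟨c, hc, hc'⟩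
      · exact Or.inl h
      · have hne : interval a e ≠ [] := by
          obtain ⟨c, t, h, -⟩ := hw.exists_head hT.good.1
          rw [h]; simp
        obtain ⟨rfl, he⟩ := interval_prefix hne hu' (hs' ▸ hw')
        exact Or.inr ⟨e, hae, he, rfl⟩
      · exact absurd (hw'.subset hc) (not_mem_drop_of_le hc' hp')
    rw [Nat.add_assoc]
    refine hF hT.good hprev hs₁ ?_ ?_ ?_ ?_ ?_ ?_ ?_ ?_
    · rw [← List.length_pos_iff, length_interval]; omega
    · rw [← List.length_pos_iff, length_interval]; omega
    · exact h₃.1.imp (by rw [length_interval]; omega) (hT.lo _ _)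
    · intro w hw hw'
      rcases hpre w p u le_rfl (by omega) hs hw (hs₁ ▸ hw') with h | ⟨e, he, hez, rfl⟩
      · rw [h, length_interval]; omega
      · have := h₃.2 e he hez
        rw [length_interval, length_interval]; omega
    · exact h₄.1.imp (by rw [length_interval]; omega) (hT.lo _ _)
    · intro w hw hw'
      have hs₂' : s.drop (p + (m - u)) =
          interval m v ++ (interval v z ++ (2 * j + 1) :: rest) := by
        rw [hs₂, ← interval_append (u := m) (m := v) (v := z) (by omega) (by omega),
          List.append_assoc]
      rcases hw with hw | ⟨hpos, rfl⟩
      · rcases hpre w _ m (by omega) (by omega) hs₂ hw (hs₂' ▸ hw') with h | ⟨e, he, hez, rfl⟩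
        · rw [h, length_interval]; omega
        · have := h₄.2 e he hez
          rw [length_interval, length_interval]; omega
      · rw [← hs₂'] at hw'
        rcases hprev' hpos with ⟨hgu, hfac⟩ | ⟨c, hc, hc'⟩
        · rw [hfac, interval_append (by omega) (by omega), hs₂] at hw'
          have := (interval_prefix (by rw [← List.length_pos_iff, length_interval]; omega)
            (by omega) hw').1
          omega
        · exact absurd (hw'.subset (List.mem_append_left _ hc))
            (not_mem_drop_of_le hc' (by omega))
    · refine h₅.imp_right ?_
      rintro ⟨e, hze, hue, hK⟩
      refine ⟨interval u e, interval u z, hT.lo _ _ hue, ?_, ?_, by rwa [length_interval]⟩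
      · rw [← interval_append (u := u) (m := z) (v := e) (by omega) (by omega)]
        exact List.prefix_append _ _
      · rw [hs]
        exact List.prefix_append _ _
    · intro T' hT' hprevT hmono hxy hback
      simp only [length_interval] at hprevT ⊢
      rw [interval_append (by omega) (by omega)] at hxy hback
      refine ih (g := m) (h₆.mono (Lo' := addPair Lo u v)
        (Up' := addPair (addPair Up g m) u v) (fun _ _ => Or.inl) ?_) ⟨hT', ?_, ?_⟩ hprevT hs₃
        (by omega) (fun _ => Or.inl ⟨h₂, ?_⟩) hN
      · rintro a e ha ((h | h) | h)
        · exact h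
        · omega
        · omega
      · rintro a e (h | ⟨rfl, rfl⟩)
        · exact hmono _ (hT.lo _ _ h)
        · exact hxy
      · intro w hw
        rcases hback w hw with h | h | rfl | ⟨hpos, rfl⟩
        · rcases hT.up w h with h | ⟨a, e, hae, rfl⟩ | ⟨c, hc, hc'⟩
          · exact Or.inl h
          · exact Or.inr (Or.inl ⟨a, e, Or.inl (Or.inl hae), rfl⟩)
          · exact Or.inr (Or.inr ⟨c, hc, not_mem_drop_of_le hc' (by omega)⟩)
        · exact Or.inl h
        · exact Or.inr (Or.inl ⟨u, v, Or.inr ⟨rfl, rfl⟩, rfl⟩)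
        · rcases hprev' hpos with ⟨hgu, hfac⟩ | ⟨c, hc, hc'⟩
          · refine Or.inr (Or.inl ⟨g, m, Or.inl (Or.inr ⟨rfl, rfl⟩), ?_⟩)
            rw [hfac, interval_append (by omega) (by omega)]
          · exact Or.inr (Or.inr ⟨c, List.mem_append_left _ hc, not_mem_drop_of_le hc' (by omega)⟩)
      · rw [Nat.add_sub_cancel]
        rw [← interval_append (u := m) (m := v) (v := z) (by omega) (by omega),
          List.append_assoc] at hs₂
        have := factor_eq_of_drop hs₂
        rwa [length_interval] at this

/-- The text of a sequence of chunks `(u, z, l)`: each interval is followed by two fresh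
separators, and the text ends with `m` more fresh letters.  Separators are odd and numbered from `k`
on. -/
def text : ℕ → List (ℕ × ℕ × List (ℕ × ℕ)) → ℕ → List ℕ
  | k, [], m => (List.range' k m).map (2 * · + 1)
  | k, (u, z, _) :: L, m => interval u z ++ (2 * k + 1) :: (2 * (k + 1) + 1) :: text (k + 2) L m

/-- The chunks in the list are parsed as intended, at a total cost of at least the fourth argument,
and turn the bounds `Lo`, `Up` for the dictionary into `Lo'`, `Up'`. -/
inductive Path : (ℕ → ℕ → Prop) → (ℕ → ℕ → Prop) → List (ℕ × ℕ × List (ℕ × ℕ)) → ℕ →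
    (ℕ → ℕ → Prop) → (ℕ → ℕ → Prop) → Prop
  | nil {Lo Up} : Path Lo Up [] 0 Lo Up
  | cons {Lo Up Lo' Up' u z l K L N} : ChunkOK Lo Up z u l K →
      Path (loAfter Lo u l) (upAfter Up u u l) L N Lo' Up' →
      Path Lo Up ((u, z, l) :: L) (K + N) Lo' Up'

theorem Path.snoc {Lo Up Lo' Up' : ℕ → ℕ → Prop} {L : List (ℕ × ℕ × List (ℕ × ℕ))} {N u z K : ℕ}
    {l : List (ℕ × ℕ)} (h : Path Lo Up L N Lo' Up') (h' : ChunkOK Lo' Up' z u l K) :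
    Path Lo Up (L ++ [(u, z, l)]) (N + K) (loAfter Lo' u l) (upAfter Up' u u l) := by
  induction h with
  | nil => rw [Nat.zero_add]; exact .cons h' .nil
  | cons h₁ _ ih => rw [Nat.add_assoc]; exact .cons h₁ (ih h')

theorem not_mem_text {j k : ℕ} (h : j < k) (L : List (ℕ × ℕ × List (ℕ × ℕ))) (m : ℕ) :
    2 * j + 1 ∉ text k L m := by
  induction L generalizing k with
  | nil =>
    simp only [text, List.mem_map, List.mem_range'_1]
    rintro ⟨a, ha, ha'⟩
    omega
  | cons c L ih =>
    obtain ⟨u, z, l⟩ := c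
    simp only [text, List.mem_append, List.mem_cons, interval, List.mem_map]
    rintro (⟨a, -, ha⟩ | h | h | h)
    · omega
    · omega
    · omega
    · exact ih (by omega) h

/-- Both algorithms parse the text of a sequence of chunks as intended. -/
theorem Path.bound {s : List ℕ} {F : Trie → ℕ → ℕ → ℕ → Prop} (hF : PairRule s F)
    (hF₀ : ∀ T prev p, F T prev p 0) {Lo Up Lo' Up' : ℕ → ℕ → Prop}
    {L : List (ℕ × ℕ × List (ℕ × ℕ))} {N k m p prev : ℕ} {T : Trie} (h : Path Lo Up L N Lo' Up')
    (hT : Dictionary s T p Lo Up) (hprev : PrevMarked s T prev p) (hs : s.drop p = text k L m)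
    (hprev' : 0 < prev → ∃ c ∈ factor s (p - prev) p, c ∉ s.drop p) : F T prev p N := by
  induction h generalizing k p prev T with
  | nil => exact hF₀ _ _ _
  | @cons Lo Up Lo' Up' u z l K L N h₁ _ ih =>
    refine h₁.bound hF hT hprev hs le_rfl (fun h => Or.inr (hprev' h)) ?_
    intro T' prev' p' hT' hprev₁ hs'
    have hs₁ : s.drop (p' + 1) = (2 * (k + 1) + 1) :: text (k + 2) L m := by
      rw [← List.drop_drop, hs']; rfl
    have hs₂ : s.drop (p' + 1 + 1) = text (k + 2) L m := by
      rw [← List.drop_drop, hs₁]; rfl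
    have hk₁ : 2 * k + 1 ∉ s.drop (p' + 1) := by
      rw [hs₁, List.mem_cons, not_or]
      exact ⟨by omega, not_mem_text (by omega) _ _⟩
    have hk₂ : 2 * (k + 1) + 1 ∉ s.drop (p' + 1 + 1) := by
      rw [hs₂]
      exact not_mem_text (by omega) _ _
    -- a marked string that starts with a separator is a letter
    have hpre : ∀ w c q t, p' ≤ q → s.drop q = (2 * c + 1) :: t → T'.Marked s w →
        w <+: s.drop q → w.length ≤ 1 := by
      intro w c q t hq hsq hw hw'
      rcases hT'.up w hw with h | ⟨a, e, -, rfl⟩ | ⟨d, hd, hd'⟩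
      · exact h.le
      · rw [hsq] at hw'
        by_contra! hlen
        rw [length_interval] at hlen
        rw [List.prefix_iff_getElem?] at hw'
        have := hw' 0 (by rw [length_interval]; omega)
        rw [← List.getElem?_eq_getElem, getElem?_interval, if_pos (by omega)] at this
        simp at this
        omega
      · exact absurd (hw'.subset hd) (not_mem_drop_of_le hd' hq)
    have hx : s.drop p' = [2 * k + 1] ++ ([2 * (k + 1) + 1] ++ text (k + 2) L m) := hs'
    rw [← Nat.zero_add N]
    refine hF hT'.good hprev₁ hx (by simp) (by simp) (Or.inl rfl) ?_ (Or.inl rfl) ?_ (Or.inl rfl) ?_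
    · intro w hw hw'
      exact hpre w k p' _ le_rfl hs' hw (hx ▸ hw')
    · rintro w (hw | ⟨-, rfl⟩) hw'
      · exact hpre w (k + 1) (p' + 1) _ (by omega) hs₁ hw (hs₁ ▸ hw')
      · refine absurd (hw'.subset (List.mem_append_right _ (List.mem_singleton_self _))) ?_
        simpa [hs₁] using hk₁
    · intro T'' hT'' hprev₂ hmono hxy hback
      refine ih (k := k + 2) ⟨hT'', fun g e h => hmono _ (hT'.lo g e h), fun w hw => ?_⟩ hprev₂ hs₂
        fun _ => ⟨2 * (k + 1) + 1, ?_, hk₂⟩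
      · rcases hback w hw with h | h | rfl | ⟨-, rfl⟩
        · rcases hT'.up w h with h | h | ⟨c, hc, hc'⟩
          · exact Or.inl h
          · exact Or.inr (Or.inl h)
          · exact Or.inr (Or.inr ⟨c, hc, not_mem_drop_of_le hc' (by simp; omega)⟩)
        · exact Or.inl h
        · exact Or.inr (Or.inr ⟨2 * (k + 1) + 1, by simp, hk₂⟩)
        · exact Or.inr (Or.inr ⟨2 * k + 1, by simp, not_mem_drop_of_le hk₁ (by simp)⟩)
      · have := factor_eq_of_drop (s := s) (p := p' + 1) (x := [2 * (k + 1) + 1]) hs₁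
        simp only [List.length_singleton, Nat.add_sub_cancel] at this ⊢
        rw [this]
        exact List.mem_singleton_self _

/-! ### Growing a text chunk by chunk -/

theorem length_text_snoc (k : ℕ) (L : List (ℕ × ℕ × List (ℕ × ℕ))) (u z : ℕ) (l : List (ℕ × ℕ))
    (m : ℕ) : (text k (L ++ [(u, z, l)]) m).length = (text k L m).length + (z - u) + 2 := by
  induction L generalizing k with
  | nil => simp [text]; omega
  | cons c L ih =>
    obtain ⟨u', z', l'⟩ := c
    simp only [List.cons_append, text, List.length_append, List.length_cons, ih]
    omega

theorem loAfter_mono {R R' : ℕ → ℕ → Prop} (h : ∀ g e, R g e → R' g e) (u : ℕ) (l : List (ℕ × ℕ))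
    (g e : ℕ) : loAfter R u l g e → loAfter R' u l g e := by
  induction l generalizing R R' u with
  | nil => exact h g e
  | cons c l ih => exact ih (fun g e => Or.imp_left (h g e)) _

theorem upAfter_mono {R R' : ℕ → ℕ → Prop} (h : ∀ g e, R g e → R' g e) (a u : ℕ) (l : List (ℕ × ℕ))
    (g e : ℕ) : upAfter R a u l g e → upAfter R' a u l g e := by
  induction l generalizing R R' a u with
  | nil => exact h g e
  | cons c l ih => exact ih (fun g e => Or.imp_left (Or.imp_left (h g e))) _ _

/-- Some sequence of chunks, with a text of length at most `n`, costs at least `N`, puts all strings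
in `req` in the dictionaries, and puts only strings allowed by `allow` there. -/
def Reachable (req allow : ℕ → ℕ → Prop) (n N : ℕ) : Prop :=
  ∃ L Lo Up N', Path (fun _ _ => False) (fun _ _ => False) L N' Lo Up ∧ N ≤ N' ∧
    (text 0 L 0).length ≤ n ∧ (∀ g e, req g e → Lo g e) ∧ ∀ g e, Up g e → allow g e

theorem Reachable.mono {req allow req' allow' : ℕ → ℕ → Prop} {n N n' N' : ℕ}
    (h : Reachable req allow n N) (hr : ∀ g e, req' g e → req g e)
    (ha : ∀ g e, allow g e → allow' g e) (hn : n ≤ n') (hN : N' ≤ N) :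
    Reachable req' allow' n' N' := by
  obtain ⟨L, Lo, Up, M, h₁, h₂, h₃, h₄, h₅⟩ := h
  exact ⟨L, Lo, Up, M, h₁, hN.trans h₂, h₃.trans hn, fun g e h => h₄ g e (hr g e h),
    fun g e h => ha g e (h₅ g e h)⟩

theorem Reachable.chunk {req allow : ℕ → ℕ → Prop} {n N u z K : ℕ} {l : List (ℕ × ℕ)}
    (h : Reachable req allow n N) (h' : ChunkOK req allow z u l K) :
    Reachable (loAfter req u l) (upAfter allow u u l) (n + (z - u) + 2) (N + K) := by
  obtain ⟨L, Lo, Up, M, h₁, h₂, h₃, h₄, h₅⟩ := h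
  refine ⟨_, _, _, _, h₁.snoc (h'.mono h₄ fun g e _ => h₅ g e), by omega, ?_, loAfter_mono h₄ u l,
    upAfter_mono h₅ u u l⟩
  rw [length_text_snoc]
  omega

/-- Extension by a chunk that consists of two factors only, which adds their concatenation to the
dictionary. -/
theorem Reachable.pair {req allow : ℕ → ℕ → Prop} {n N : ℕ} (h : Reachable req allow n N) (u m v : ℕ)
    (hum : u < m) (hmv : m < v) (h₁ : m = u + 1 ∨ req u m) (h₂ : v = m + 1 ∨ req m v)
    (h₃ : ∀ e, allow u e → e ≤ v → e ≤ m) :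
    Reachable (addPair req u v) (addPair (addPair allow u m) u v) (n + (v - u) + 2) N :=
  h.chunk (l := [(m, v)]) (K := 0)
    (.cons (K := 0) hum hmv ⟨h₁, h₃⟩ ⟨h₂, fun _ _ => id⟩ (Or.inl rfl) .nil)

/-! ### The hard text -/

/-! The word `0, 2, …, 2 q T` consists of `q` blocks of length `T = 3 h + 2` and of one more letter,
which never occurs in the phases.  In its block, a letter has an offset from `0` to `3 h + 1`. -/

/-- The strings that are needed in the dictionary, for each block from block `A` on: the string from
the block to the end of the word, the prefix of the block of length `x a`, and the suffixes of the
block that start at offsets `3 j + 1`. -/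
def Required (h q A : ℕ) (x : ℕ → ℕ) (g e : ℕ) : Prop :=
  ∃ a, A ≤ a ∧ a < q ∧ ((g = a * (3 * h + 2) ∧ (e = q * (3 * h + 2) + 1 ∨ e = a * (3 * h + 2) + x a)) ∨
    ∃ j < h, g = a * (3 * h + 2) + 3 * j + 1 ∧ e = (a + 1) * (3 * h + 2))

/-- The strings that may be in the dictionary in phase `i`: at the beginning of a block, only the
string to the end of the word and short prefixes of the block; behind offset `3 i + 1`, only strings
that start at an offset `3 j + 1` and either stay within the block or extend to the end of the
word. -/
def Allowed (h q : ℕ) (x : ℕ → ℕ) (i g e : ℕ) : Prop :=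
  ∀ a o, o < 3 * h + 2 → g = a * (3 * h + 2) + o →
    (o = 0 → e = q * (3 * h + 2) + 1 ∨ e ≤ a * (3 * h + 2) + x a) ∧
    (3 * i + 1 < o → o % 3 = 1 ∧ (e ≤ (a + 1) * (3 * h + 2) ∨ e = q * (3 * h + 2) + 1))

theorem block_offset_unique {T a a' o o' : ℕ} (ho : o < T) (ho' : o' < T)
    (h : a * T + o = a' * T + o') : a = a' ∧ o = o' := by
  have hT : 0 < T := by omega
  have h₁ := congrArg (· / T) h
  have h₂ := congrArg (· % T) h
  simp only [mul_comm a, mul_comm a', Nat.mul_add_div hT, Nat.mul_add_mod, Nat.div_eq_of_lt ho,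
    Nat.div_eq_of_lt ho', Nat.mod_eq_of_lt ho, Nat.mod_eq_of_lt ho', add_zero] at h₁ h₂
  exact ⟨h₁, h₂⟩

/-- To check that a string is allowed, it suffices to consider the block and offset of its start. -/
theorem allowed_of_offset {h q i a o g e : ℕ} {x : ℕ → ℕ} (ho : o < 3 * h + 2)
    (hg : g = a * (3 * h + 2) + o)
    (h₁ : o = 0 → e = q * (3 * h + 2) + 1 ∨ e ≤ a * (3 * h + 2) + x a)
    (h₂ : 3 * i + 1 < o → o % 3 = 1 ∧ (e ≤ (a + 1) * (3 * h + 2) ∨ e = q * (3 * h + 2) + 1)) :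
    Allowed h q x i g e := by
  intro a' o' ho' hg'
  obtain ⟨rfl, rfl⟩ := block_offset_unique ho ho' (hg.symm.trans hg')
  exact ⟨h₁, h₂⟩

/-- The suffixes of block `a` starting at offsets `3 j + 1`, for the last `d` values of `j`, are put
into the dictionary by prepending blocks of three letters. -/
theorem reachable_suffixes {h q a n N : ℕ} {x : ℕ → ℕ}
    (H : Reachable (Required h q (a + 1) x)
      (fun g e => (a + 1) * (3 * h + 2) ≤ g ∧ Allowed h q x 0 g e) n N) (d : ℕ) (hd : d ≤ h) :
    Reachable
      (fun g e => Required h q (a + 1) x g e ∨ ∃ j, h - d ≤ j ∧ j < h ∧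
        g = a * (3 * h + 2) + 3 * j + 1 ∧ e = (a + 1) * (3 * h + 2))
      (fun g e => a * (3 * h + 2) + 3 * (h - d) + 1 ≤ g ∧ Allowed h q x 0 g e ∧
        (g < (a + 1) * (3 * h + 2) → e ≤ (a + 1) * (3 * h + 2)))
      (n + d * (3 * h + 2 + 11)) N := by
  have hT : (a + 1) * (3 * h + 2) = a * (3 * h + 2) + (3 * h + 2) := by ring
  induction d with
  | zero =>
    refine H.mono (fun g e => ?_) (fun g e => ?_) (by omega) le_rfl
    · rintro (h | ⟨j, h₁, h₂, -⟩)
      · exact h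
      · omega
    · rintro ⟨h₁, h₂⟩
      exact ⟨by omega, h₂, by omega⟩
  | succ d ih =>
    obtain ⟨i, hi⟩ : ∃ i, h = i + (d + 1) := ⟨h - (d + 1), by omega⟩
    have hid : h - d = i + 1 := by omega
    have hid' : h - (d + 1) = i := by omega
    rw [hid']
    have ih := ih (by omega)
    rw [hid] at ih
    generalize hu : a * (3 * h + 2) + 3 * i + 1 = u at *
    -- two letters, then three letters, then these followed by the previous suffix
    have s₁ := ih.pair u (u + 1) (u + 2) (by omega) (by omega) (Or.inl rfl) (Or.inl rfl) (by
      rintro e ⟨h, -⟩; omega)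
    have s₂ := s₁.pair u (u + 2) (u + 3) (by omega) (by omega) (Or.inr (Or.inr ⟨rfl, rfl⟩))
      (Or.inl rfl) (by rintro e ((⟨h, -⟩ | h) | h) <;> omega)
    have s₃ := s₂.pair u (u + 3) ((a + 1) * (3 * h + 2)) (by omega) (by omega)
      (Or.inr (Or.inr ⟨rfl, rfl⟩)) (by
        rcases Nat.eq_zero_or_pos d with rfl | hd
        · left; omega
        · exact Or.inr (Or.inl (Or.inl (Or.inr ⟨i + 1, le_rfl, by omega, by omega, rfl⟩))))
      (by rintro e ((((⟨h, -⟩ | h) | h) | h) | h) <;> omega)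
    refine s₃.mono (fun g e => ?_) (fun g e => ?_) ?_ le_rfl
    · rintro (h | ⟨j, h₁, h₂, rfl, rfl⟩)
      · exact Or.inl (Or.inl (Or.inl (Or.inl h)))
      · rcases Nat.eq_or_lt_of_le h₁ with rfl | h₁
        · exact Or.inr ⟨hu, rfl⟩
        · exact Or.inl (Or.inl (Or.inl (Or.inr ⟨j, h₁, h₂, rfl, rfl⟩)))
    · have new : ∀ e, e ≤ (a + 1) * (3 * h + 2) → u ≤ u ∧ Allowed h q x 0 u e ∧
          (u < (a + 1) * (3 * h + 2) → e ≤ (a + 1) * (3 * h + 2)) := fun e he =>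
        ⟨le_rfl, allowed_of_offset (a := a) (o := 3 * i + 1) (by omega) (by omega) (by omega)
          (fun _ => ⟨by omega, Or.inl he⟩), fun _ => he⟩
      rintro ((((((⟨h, h'⟩ | ⟨rfl, rfl⟩) | ⟨rfl, rfl⟩) | ⟨rfl, rfl⟩) | ⟨rfl, rfl⟩) | ⟨rfl, rfl⟩) |
        ⟨rfl, rfl⟩)
      · exact ⟨by omega, h'⟩
      all_goals exact new _ (by omega)
    · rw [Nat.add_one_mul d]; omega

/-- The required strings of one more block. -/
theorem reachable_block {h q a n N : ℕ} (hh : 0 < h) (ha : a < q)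
    (H : Reachable (Required h q (a + 1) fun _ => 2)
      (fun g e => (a + 1) * (3 * h + 2) ≤ g ∧ Allowed h q (fun _ => 2) 0 g e) n N) :
    Reachable (Required h q a fun _ => 2)
      (fun g e => a * (3 * h + 2) ≤ g ∧ Allowed h q (fun _ => 2) 0 g e)
      (n + (h * (3 * h + 2 + 11) + 2 * (q * (3 * h + 2) + 3) + 4)) N := by
  have hT : (a + 1) * (3 * h + 2) = a * (3 * h + 2) + (3 * h + 2) := by ring
  have hq : (a + 1) * (3 * h + 2) ≤ q * (3 * h + 2) := Nat.mul_le_mul_right _ ha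
  have s₀ := reachable_suffixes H h le_rfl
  rw [Nat.sub_self] at s₀
  -- the string from this block to the end of the word, in two steps; its first factor must be a
  -- single letter, since otherwise a longer prefix of the block would be marked
  have s₁ := s₀.pair (a * (3 * h + 2) + 1) ((a + 1) * (3 * h + 2)) (q * (3 * h + 2) + 1)
    (by omega) (by omega) (Or.inr (Or.inr ⟨0, le_rfl, hh, rfl, rfl⟩)) (by
      rcases Nat.eq_or_lt_of_le (show a + 1 ≤ q from ha) with rfl | hq
      · exact Or.inl rfl
      · exact Or.inr (Or.inl ⟨a + 1, le_rfl, hq, Or.inl ⟨rfl, Or.inl rfl⟩⟩))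
    (fun e he _ => he.2.2 (by omega))
  have s₂ := s₁.pair (a * (3 * h + 2)) (a * (3 * h + 2) + 1) (q * (3 * h + 2) + 1)
    (by omega) (by omega) (Or.inl rfl) (Or.inr (Or.inr ⟨rfl, rfl⟩))
    (by rintro e ((⟨h, -⟩ | h) | h) <;> omega)
  -- the prefix of length `2`
  have s₃ := s₂.pair (a * (3 * h + 2)) (a * (3 * h + 2) + 1) (a * (3 * h + 2) + 2)
    (by omega) (by omega) (Or.inl rfl) (Or.inl rfl)
    (by rintro e ((((⟨h, -⟩ | h) | h) | h) | h) <;> omega)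
  refine s₃.mono (fun g e => ?_) (fun g e => ?_) (by omega) le_rfl
  · rintro ⟨b, hb, hb', hbe⟩
    rcases Nat.eq_or_lt_of_le hb with rfl | hb
    · rcases hbe with ⟨rfl, rfl | rfl⟩ | ⟨j, hj, rfl, rfl⟩
      · exact Or.inl (Or.inr ⟨rfl, rfl⟩)
      · exact Or.inr ⟨rfl, rfl⟩
      · exact Or.inl (Or.inl (Or.inl (Or.inr ⟨j, Nat.zero_le _, hj, rfl, rfl⟩)))
    · exact Or.inl (Or.inl (Or.inl (Or.inl ⟨b, hb, hb', hbe⟩)))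
  · have new₁ : ∀ e, Allowed h q (fun _ => 2) 0 (a * (3 * h + 2) + 1) e := fun e =>
      allowed_of_offset (a := a) (o := 1) (by omega) rfl (by omega) (by omega)
    have new₀ : ∀ e, (e = q * (3 * h + 2) + 1 ∨ e ≤ a * (3 * h + 2) + 2) →
        Allowed h q (fun _ => 2) 0 (a * (3 * h + 2)) e := fun e he =>
      allowed_of_offset (a := a) (o := 0) (by omega) rfl (fun _ => he) (by omega)
    rintro ((((((⟨h, h', -⟩ | ⟨rfl, rfl⟩) | ⟨rfl, rfl⟩) | ⟨rfl, rfl⟩) | ⟨rfl, rfl⟩) | ⟨rfl, rfl⟩) |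
      ⟨rfl, rfl⟩)
    · exact ⟨by omega, h'⟩
    · exact ⟨by omega, new₁ _⟩
    · exact ⟨by omega, new₁ _⟩
    · exact ⟨le_rfl, new₀ _ (by omega)⟩
    · exact ⟨le_rfl, new₀ _ (by omega)⟩
    · exact ⟨le_rfl, new₀ _ (by omega)⟩
    · exact ⟨le_rfl, new₀ _ (by omega)⟩

theorem reachable_blocks {h q : ℕ} (hh : 0 < h) (d : ℕ) (hd : d ≤ q) :
    Reachable (Required h q (q - d) fun _ => 2)
      (fun g e => (q - d) * (3 * h + 2) ≤ g ∧ Allowed h q (fun _ => 2) 0 g e)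
      (d * (h * (3 * h + 2 + 11) + 2 * (q * (3 * h + 2) + 3) + 4)) 0 := by
  induction d with
  | zero =>
    refine ⟨[], _, _, 0, .nil, le_rfl, by simp [text], ?_, fun _ _ h => h.elim⟩
    rintro g e ⟨a, h₁, h₂, -⟩
    omega
  | succ d ih =>
    have := ih (by omega)
    rw [show q - d = q - (d + 1) + 1 by omega] at this
    have := reachable_block hh (by omega) this
    rwa [← Nat.succ_mul] at this

/-- The chunk of phase `i`, restricted to `k` blocks from block `a` on.  Each block is cut into its
prefix of length `3 i + 2`, two single letters, and a suffix. -/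
def phaseChunk (h i : ℕ) : ℕ → ℕ → List (ℕ × ℕ)
  | 0, _ => []
  | k + 1, a => (a * (3 * h + 2) + 3 * i + 2, a * (3 * h + 2) + 3 * i + 3) ::
      (a * (3 * h + 2) + 3 * i + 4, (a + 1) * (3 * h + 2)) :: phaseChunk h i k (a + 1)

/-- At the beginning of each block, the search runs to the end of the chunk, since the dictionary
contains the string to the end of the word, which is one letter longer.  For the same reason, this
string is not a candidate for the factor. -/
theorem chunkOK_phaseChunk {h q i : ℕ} (hi : i < h) (k a : ℕ) (hak : a + k = q) :
    ChunkOK (Required h q 0 fun _ => 3 * i + 2) (Allowed h q (fun _ => 3 * i + 2) i)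
      (q * (3 * h + 2)) (a * (3 * h + 2)) (phaseChunk h i k a)
      (∑ j ∈ Finset.range (k + 1), j * (3 * h + 2)) := by
  induction k generalizing a with
  | zero =>
    obtain rfl : a = q := hak
    simpa [phaseChunk] using ChunkOK.nil
  | succ k ih =>
    have hT : (a + 1) * (3 * h + 2) = a * (3 * h + 2) + (3 * h + 2) := by ring
    have hq : q * (3 * h + 2) = a * (3 * h + 2) + (k + 1) * (3 * h + 2) := by rw [← hak]; ring
    have hk : (k + 1) * (3 * h + 2) = k * (3 * h + 2) + (3 * h + 2) := by ring
    have hsum : ∑ j ∈ Finset.range (k + 1 + 1), j * (3 * h + 2) =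
        (k + 1) * (3 * h + 2) + (0 + ∑ j ∈ Finset.range (k + 1), j * (3 * h + 2)) := by
      rw [Finset.sum_range_succ]; ring
    rw [hsum]
    refine .cons (by omega) (by omega) ⟨?_, ?_⟩ ⟨Or.inl (by omega), ?_⟩ (Or.inr ⟨_, ?_,
      ⟨a, Nat.zero_le _, by omega, Or.inl ⟨rfl, Or.inl rfl⟩⟩, by omega⟩)
      (.cons (by omega) (by omega) ⟨Or.inl (by omega), ?_⟩ ⟨?_, ?_⟩ (Or.inl rfl)
      (ih (a + 1) (by omega)))
    · exact Or.inr ⟨a, Nat.zero_le _, by omega, Or.inl ⟨rfl, Or.inr (by dsimp only; omega)⟩⟩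
    · intro e he hez
      have := (he a 0 (by omega) rfl).1 rfl
      dsimp only at this
      omega
    · intro e he hez
      have := (he a (3 * i + 2) (by omega) (by omega)).2 (by omega)
      omega
    · omega
    · intro e he hez
      have := (he a (3 * i + 3) (by omega) (by omega)).2 (by omega)
      omega
    · rcases Nat.eq_or_lt_of_le (show i + 1 ≤ h from hi) with h' | h'
      · left; omega
      · exact Or.inr ⟨a, Nat.zero_le _, by omega, Or.inr ⟨i + 1, h', by omega, rfl⟩⟩
    · intro e he hez
      have := (he a (3 * i + 4) (by omega) (by omega)).2 (by omega)
      omega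

theorem loAfter_of (R : ℕ → ℕ → Prop) (u : ℕ) (l : List (ℕ × ℕ)) {g e : ℕ} (h : R g e) :
    loAfter R u l g e := by
  induction l generalizing R u with
  | nil => exact h
  | cons c l ih => exact ih _ _ (Or.inl h)

theorem loAfter_phaseChunk (R : ℕ → ℕ → Prop) (h i k a b : ℕ) (hb : a ≤ b) (hb' : b < a + k) :
    loAfter R (a * (3 * h + 2)) (phaseChunk h i k a) (b * (3 * h + 2))
      (b * (3 * h + 2) + 3 * i + 3) := by
  induction k generalizing R a with
  | zero => omega
  | succ k ih =>
    rcases Nat.eq_or_lt_of_le hb with rfl | hb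
    · exact loAfter_of (addPair (addPair R _ _) _ _) ((a + 1) * (3 * h + 2))
        (phaseChunk h i k (a + 1)) (Or.inl (Or.inr ⟨rfl, rfl⟩))
    · exact ih _ _ hb (by omega)

theorem upAfter_phaseChunk {R P : ℕ → ℕ → Prop} {h i : ℕ} (k a u : ℕ) (hR : ∀ g e, R g e → P g e)
    (h₀ : P u (a * (3 * h + 2) + 3 * i + 2))
    (h₁ : ∀ a, P (a * (3 * h + 2)) (a * (3 * h + 2) + 3 * i + 3))
    (h₂ : ∀ a, P (a * (3 * h + 2) + 3 * i + 2) (a * (3 * h + 2) + 3 * i + 4))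
    (h₃ : ∀ a, P (a * (3 * h + 2) + 3 * i + 3) ((a + 1) * (3 * h + 2)))
    (h₄ : ∀ a, P (a * (3 * h + 2) + 3 * i + 4) ((a + 1) * (3 * h + 2) + 3 * i + 2)) (g e : ℕ) :
    upAfter R u (a * (3 * h + 2)) (phaseChunk h i k a) g e → P g e := by
  induction k generalizing R a u with
  | zero => exact hR g e
  | succ k ih =>
    refine ih (a + 1) _ ?_ (h₄ a)
    rintro g e ((((h | ⟨rfl, rfl⟩) | ⟨rfl, rfl⟩) | ⟨rfl, rfl⟩) | ⟨rfl, rfl⟩)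
    exacts [hR _ _ h, h₀, h₁ a, h₂ a, h₃ a]

/-- After the chunk of a phase, the prefixes in the dictionary are extended by two letters, first by
one, then by another one. -/
theorem reachable_prefixes {h q i n N : ℕ} (hi : i < h)
    (H : Reachable (Required h q 0 fun _ => 3 * i + 3) (Allowed h q (fun _ => 3 * i + 3) (i + 1))
      n N) (d : ℕ) (hd : d ≤ q) :
    Reachable (Required h q 0 fun a => if a < d then 3 * i + 5 else 3 * i + 3)
      (Allowed h q (fun a => if a < d then 3 * i + 5 else 3 * i + 3) (i + 1))
      (n + d * (2 * (3 * h + 2) + 4)) N := by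
  induction d with
  | zero => simpa using H
  | succ d ih =>
    have hT : (d + 1) * (3 * h + 2) = d * (3 * h + 2) + (3 * h + 2) := by ring
    have hq : (d + 1) * (3 * h + 2) ≤ q * (3 * h + 2) := Nat.mul_le_mul_right _ hd
    generalize hu : d * (3 * h + 2) = u at *
    have s₁ := (ih (by omega)).pair u (u + 3 * i + 3) (u + 3 * i + 4) (by omega) (by omega)
      (Or.inr ⟨d, Nat.zero_le _, by omega, Or.inl ⟨hu.symm, Or.inr (by simp; omega)⟩⟩)
      (Or.inl rfl) (fun e he he' => by
        have := (he d 0 (by omega) hu.symm).1 rfl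
        simp only [lt_irrefl, if_false, hu] at this
        omega)
    have s₂ := s₁.pair u (u + 3 * i + 4) (u + 3 * i + 5) (by omega) (by omega)
      (Or.inr (Or.inr ⟨rfl, rfl⟩)) (Or.inl rfl) (by
        rintro e ((he | he) | he) he'
        · have := (he d 0 (by omega) hu.symm).1 rfl
          simp only [lt_irrefl, if_false, hu] at this
          omega
        · omega
        · omega)
    refine s₂.mono (fun g e => ?_) (fun g e => ?_) ?_ le_rfl
    · rintro ⟨a, ha, ha', hae⟩
      rcases eq_or_ne a d with rfl | hne
      · rcases hae with ⟨rfl, rfl | rfl⟩ | hae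
        · exact Or.inl (Or.inl ⟨a, ha, ha', Or.inl ⟨rfl, Or.inl rfl⟩⟩)
        · exact Or.inr ⟨hu, by simp; omega⟩
        · exact Or.inl (Or.inl ⟨a, ha, ha', Or.inr hae⟩)
      · refine Or.inl (Or.inl ⟨a, ha, ha', ?_⟩)
        have hlt : a < d + 1 ↔ a < d := by omega
        simpa only [hlt] using hae
    · have new : ∀ e, e ≤ u + 3 * i + 5 →
          Allowed h q (fun a => if a < d + 1 then 3 * i + 5 else 3 * i + 3) (i + 1) u e := fun e he =>
        allowed_of_offset (a := d) (o := 0) (by omega) hu.symm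
          (fun _ => Or.inr (by simp; omega)) (by omega)
      rintro ((((h | ⟨rfl, rfl⟩) | ⟨rfl, rfl⟩) | ⟨rfl, rfl⟩) | ⟨rfl, rfl⟩)
      · intro a o ho hg
        refine ⟨fun ho => ((h a o ‹_› hg).1 ho).imp_right fun h => h.trans ?_, (h a o ho hg).2⟩
        dsimp only
        split_ifs <;> omega
      all_goals exact new _ (by omega)
    · rw [Nat.add_one_mul d]; omega

/-- Phases `0, …, i - 1`. -/
theorem reachable_phases {h q n N : ℕ}
    (H : Reachable (Required h q 0 fun _ => 2) (Allowed h q (fun _ => 2) 0) n N) (i : ℕ)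
    (hi : i ≤ h) :
    Reachable (Required h q 0 fun _ => 3 * i + 2) (Allowed h q (fun _ => 3 * i + 2) i)
      (n + i * (q * (3 * h + 2) + 2 + q * (2 * (3 * h + 2) + 4)))
      (N + i * ∑ j ∈ Finset.range (q + 1), j * (3 * h + 2)) := by
  induction i with
  | zero => simpa using H
  | succ i ih =>
    have s₁ := (ih (by omega)).chunk (chunkOK_phaseChunk (q := q) (i := i) hi q 0 (by omega))
    have s₂ := s₁.mono (req' := Required h q 0 fun _ => 3 * i + 3)
      (allow' := Allowed h q (fun _ => 3 * i + 3) (i + 1)) ?_ ?_ le_rfl le_rfl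
    · refine (reachable_prefixes hi s₂ q le_rfl).mono (fun g e => ?_) (fun g e => ?_) ?_ ?_
      · rintro ⟨a, ha, ha', h⟩
        exact ⟨a, ha, ha', by
          simp only [if_pos ha']
          exact h⟩
      · intro h a o ho hg
        refine ⟨fun ho' => ((h a o ho hg).1 ho').imp_right fun h => h.trans ?_, (h a o ho hg).2⟩
        dsimp only
        split_ifs <;> omega
      · rw [Nat.add_one_mul i]; omega
      · rw [Nat.add_one_mul i]; omega
    · rintro g e ⟨a, ha, ha', ⟨rfl, rfl | rfl⟩ | h⟩
      · exact loAfter_of _ _ _ ⟨a, ha, ha', Or.inl ⟨rfl, Or.inl rfl⟩⟩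
      · exact loAfter_phaseChunk _ _ _ _ _ _ ha (by omega)
      · exact loAfter_of _ _ _ ⟨a, ha, ha', Or.inr h⟩
    · refine upAfter_phaseChunk q 0 _ ?_ ?_ ?_ ?_ ?_ ?_
      · intro g e h a o ho hg
        refine ⟨fun ho' => ((h a o ho hg).1 ho').imp_right fun h => h.trans (by dsimp only; omega),
          fun ho' => (h a o ho hg).2 (by omega)⟩
      · exact allowed_of_offset (a := 0) (o := 0) (by omega) rfl (fun _ => by omega) (by omega)
      · exact fun a => allowed_of_offset (a := a) (o := 0) (by omega) rfl (fun _ => by omega)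
          (by omega)
      · exact fun a => allowed_of_offset (a := a) (o := 3 * i + 2) (by omega) (by omega) (by omega)
          (by omega)
      · exact fun a => allowed_of_offset (a := a) (o := 3 * i + 3) (by omega) (by omega) (by omega)
          (by omega)
      · exact fun a => allowed_of_offset (a := a) (o := 3 * i + 4) (by omega) (by omega) (by omega)
          (by omega)

/-- A text of length `O(k ^ 3)` whose parsing takes at least `k ^ 4` steps. -/
theorem reachable_hard (k : ℕ) (hk : 0 < k) :
    Reachable (fun _ _ => False) (fun _ _ => True) (57 * k ^ 3) (k ^ 4) := by
  have s := reachable_blocks (h := k) (q := k) hk k le_rfl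
  have s' := reachable_phases (s.mono (req' := Required k k 0 fun _ => 2)
    (allow' := Allowed k k (fun _ => 2) 0) (fun g e h => by rwa [Nat.sub_self])
    (fun g e h => h.2) le_rfl le_rfl) k le_rfl
  refine s'.mono (fun _ _ h => h.elim) (fun _ _ _ => trivial) ?_ ?_
  · have h₁ : k ≤ k ^ 3 := Nat.le_self_pow (by omega) k
    have h₂ : k ^ 2 ≤ k ^ 3 := Nat.pow_le_pow_right hk (by omega)
    ring_nf
    omega
  · rw [← Finset.sum_mul, zero_add]
    have h₁ := Finset.sum_range_id_mul_two (k + 1)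
    rw [Nat.add_sub_cancel] at h₁
    have h₂ : 2 * k ^ 4 ≤ 2 * (k * ((∑ j ∈ Finset.range (k + 1), j) * (3 * k + 2))) := by
      calc 2 * k ^ 4 ≤ k * ((k + 1) * k * (3 * k + 2)) := by ring_nf; omega
        _ = _ := by rw [← h₁]; ring
    omega

/-! ### The lower bounds -/

theorem length_text_add (k : ℕ) (L : List (ℕ × ℕ × List (ℕ × ℕ))) (m : ℕ) :
    (text k L m).length = (text k L 0).length + m := by
  induction L generalizing k with
  | nil => simp [text]
  | cons c L ih =>
    obtain ⟨u, z, l⟩ := c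
    simp only [text, List.length_append, List.length_cons, ih (k + 2)]
    omega

theorem exists_text_succ (k : ℕ) (L : List (ℕ × ℕ × List (ℕ × ℕ))) (m : ℕ) :
    ∃ j, k ≤ j ∧ text k L (m + 1) = text k L m ++ [2 * j + 1] ∧ 2 * j + 1 ∉ text k L m := by
  induction L generalizing k with
  | nil =>
    refine ⟨k + m, by omega, by simp [text, List.range'_concat], ?_⟩
    simp only [text, List.mem_map, List.mem_range'_1]
    rintro ⟨a, ha, ha'⟩
    omega
  | cons c L ih =>
    obtain ⟨u, z, l⟩ := c
    obtain ⟨j, hj, h₁, h₂⟩ := ih (k + 2)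
    refine ⟨j, by omega, by simp [text, h₁], ?_⟩
    simp only [text, List.mem_append, List.mem_cons, interval, List.mem_map]
    rintro (⟨a, -, ha⟩ | h | h | h)
    · omega
    · omega
    · omega
    · exact h₂ h

theorem endsWithDelimiter_text (L : List (ℕ × ℕ × List (ℕ × ℕ))) (m : ℕ) :
    EndsWithDelimiter (text 0 L (m + 1)) := by
  obtain ⟨j, -, h₁, h₂⟩ := exists_text_succ 0 L m
  exact ⟨_, _, h₁, h₂⟩

/-- For every `n ≥ 58 k ^ 3` with `k > 0`, there is a string of length `n` on which both algorithms
take at least `k ^ 4` steps. -/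
theorem exists_hard_string {k n : ℕ} (hk : 0 < k) (hn : 58 * k ^ 3 ≤ n) :
    ∃ s : List ℕ, s.length = n ∧ EndsWithDelimiter s ∧ k ^ 4 ≤ (lzd s).steps ∧
      k ^ 4 ≤ (lzmw s).steps := by
  obtain ⟨L, Lo, Up, N, hP, hN, hlen, -⟩ := reachable_hard k hk
  have hk3 : 0 < k ^ 3 := Nat.pow_pos hk
  obtain ⟨m, rfl⟩ : ∃ m, n = (text 0 L 0).length + (m + 1) :=
    ⟨n - (text 0 L 0).length - 1, by omega⟩
  have hD : Dictionary (text 0 L (m + 1)) .leaf 0 (fun _ _ => False) (fun _ _ => False) :=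
    ⟨Trie.good_leaf _, fun _ _ h => h.elim, fun _ h => h.elim⟩
  have hprev : PrevMarked (text 0 L (m + 1)) .leaf 0 0 := ⟨le_rfl, fun h => absurd h (by simp)⟩
  refine ⟨text 0 L (m + 1), length_text_add _ _ _, endsWithDelimiter_text L m, hN.trans ?_,
    hN.trans ?_⟩
  · exact hP.bound (lzd_pairRule _) (fun _ _ _ _ _ => Nat.zero_le _) hD hprev rfl
      (fun h => absurd h (by simp)) _ (Nat.sub_le _ _)
  · exact hP.bound (lzmw_pairRule _) (fun _ _ _ _ _ => Nat.zero_le _) hD hprev rfl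
      (fun h => absurd h (by simp)) _ (Nat.sub_le _ _)

/-- The largest `k` with `58 k ^ 3 ≤ n` satisfies `n ^ (5 / 4) ≤ n ^ (4 / 3) ≤ (8 k) ^ 4`. -/
theorem exists_scale {n : ℕ} (hn : 58 ≤ n) :
    ∃ k : ℕ, 0 < k ∧ 58 * k ^ 3 ≤ n ∧ 1 / 4096 * (n : ℝ) ^ (5 / 4 : ℝ) ≤ ((k ^ 4 : ℕ) : ℝ) := by
  have hle : ∀ k : ℕ, k ≤ k ^ 3 := fun k => Nat.le_self_pow (by omega) k
  refine ⟨Nat.findGreatest (fun k => 58 * k ^ 3 ≤ n) n, ?_, ?_, ?_⟩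
  · exact Nat.le_findGreatest (P := fun k => 58 * k ^ 3 ≤ n) (by omega) (by omega)
  · exact Nat.findGreatest_spec (P := fun k => 58 * k ^ 3 ≤ n) (m := 1) (by omega) (by omega)
  · have hk : 1 ≤ Nat.findGreatest (fun k => 58 * k ^ 3 ≤ n) n :=
      Nat.le_findGreatest (P := fun k => 58 * k ^ 3 ≤ n) (by omega) (by omega)
    have hk' : n < 58 * (Nat.findGreatest (fun k => 58 * k ^ 3 ≤ n) n + 1) ^ 3 := by
      by_contra! h
      have := Nat.le_findGreatest (P := fun k => 58 * k ^ 3 ≤ n) (n := n)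
        (by have := hle (Nat.findGreatest (fun k => 58 * k ^ 3 ≤ n) n + 1); omega) h
      omega
    generalize Nat.findGreatest (fun k => 58 * k ^ 3 ≤ n) n = k at *
    have h₁ : n ≤ (8 * k) ^ 3 := by
      have : (k + 1) ^ 3 ≤ (2 * k) ^ 3 := Nat.pow_le_pow_left (by omega) 3
      rw [mul_pow] at this ⊢
      omega
    have h₂ : (n : ℝ) ^ (5 / 4 : ℝ) ≤ ((8 * k : ℝ)) ^ 4 := by
      calc (n : ℝ) ^ (5 / 4 : ℝ) ≤ (n : ℝ) ^ (4 / 3 : ℝ) :=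
            Real.rpow_le_rpow_of_exponent_le (by exact_mod_cast (by omega : 1 ≤ n)) (by norm_num)
        _ ≤ ((8 * k : ℝ) ^ (3 : ℕ)) ^ (4 / 3 : ℝ) :=
            Real.rpow_le_rpow (by positivity) (by exact_mod_cast h₁) (by norm_num)
        _ = (8 * k : ℝ) ^ 4 := by
            rw [← Real.rpow_natCast, ← Real.rpow_mul (by positivity), ← Real.rpow_natCast]
            norm_num
    push_cast
    rw [mul_pow] at h₂
    linarith

end NaiveLZ

theorem mainTheorem3 :
    (∃ c : ℝ, 0 < c ∧ ∃ N : ℕ, ∀ n : ℕ, N ≤ n →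
      ∃ s : List ℕ, s.length = n ∧ NaiveLZ.EndsWithDelimiter s ∧
        c * (n : ℝ) ^ (5 / 4 : ℝ) ≤ ((NaiveLZ.lzd s).steps : ℝ)) ∧
    (∃ c : ℝ, 0 < c ∧ ∃ N : ℕ, ∀ n : ℕ, N ≤ n →
      ∃ s : List ℕ, s.length = n ∧ NaiveLZ.EndsWithDelimiter s ∧
        c * (n : ℝ) ^ (5 / 4 : ℝ) ≤ ((NaiveLZ.lzmw s).steps : ℝ)) := by
  refine ⟨⟨1 / 4096, by norm_num, 58, fun n hn => ?_⟩, ⟨1 / 4096, by norm_num, 58, fun n hn => ?_⟩⟩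
  all_goals
    obtain ⟨k, hk, hkn, hkc⟩ := NaiveLZ.exists_scale hn
    obtain ⟨s, hs, hd, h₁, h₂⟩ := NaiveLZ.exists_hard_string hk hkn
    refine ⟨s, hs, hd, hkc.trans ?_⟩
  · exact_mod_cast h₁
  · exact_mod_cast h₂
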